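/- **Setting.** Let $\boldsymbol x_1,\boldsymbol x_2,\dots\in\mathbb R^d$ be deterministic covariates, $\boldsymbol\beta\in\mathbb R^d$, $\lambda_0\ge 0$ a measurable baseline hazard rate, $\Lambda_0(t)=\int_0^t\lambda_0(s)\,ds$, and $\zeta\in(0,\infty)$. The event times $\tilde T_i\in(0,\infty)$ satisfy $\Pr(\tilde T_i>t)=\exp(-e^{\boldsymbol x_i^{\rm T}\boldsymbol\beta}\Lambda_0(t))$ for $t\ge0$, the censoring times satisfy $C_i\in(0,\zeta]$, the $\tilde T_i$ are independent, the $C_i$ are independent, and $(\tilde T_i)_i$ is independent of $(C_i)_i$. For each sample size $n$ let $\tau=\tau_n>0$ be such that $\zeta$ is a multiple of $\tau$, and put $\Omega=\{\tau,2\tau,\dots,\zeta\}$, $\tilde T_i^*=\tau\lceil\tilde T_i/\tau\rceil$, $C_i^*=\tau\lceil C_i/\tau\rceil$, $T_i^*=\min(\tilde T_i^*,C_i^*)$, $\delta_i=\mathbb 1(\tilde T_i^*\le C_i^*)$, $N_i(t)=\mathbb 1(T_i^*\le t,\delta_i=1)$, $Y_i(t)=\mathbb 1(T_i^*\ge t)$,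 $N=\sum_{i\le n}N_i$. Write $dN_i(t),dN(t)$ for the jumps at $t$. Let $\mathcal D(t)=\{i\le n:T_i^*=t,\delta_i=1\}$, $\mathcal R(t)=\{i\le n:T_i^*\ge t\}$, $d(t)=|\mathcal D(t)|$, $n(t)=|\mathcal R(t)|$, $\mathcal F_{t^-}=\sigma\{N_i(u),Y_i(u): i\le n,\,0\le u<t\}$, $d\Lambda_0^*(t)=\Lambda_0(t)-\Lambda_0(t-\tau)$ for $t\in\Omega$. Write $X_n=\mathcal O_{\rm P}(Z_n)$ if $\Pr(|X_n|>K|Z_n|)\to0$ for some $K>0$. The Breslow partial likelihood is $$L^{\rm b}(\boldsymbol b)=\prod_{t\in\Omega}\frac{d(t)!\,\exp\big(\sum_{i\in\mathcal D(t)}\boldsymbol x_i^{\rm T}\boldsymbol b\big)}{\big\{\sum_{i\in\mathcal R(t)}\exp(\boldsymbol x_i^{\rm T}\boldsymbol b)\big\}^{d(t)}},$$ and the Breslow estimator $\widehat{\boldsymbol\beta}_{\rm b}$ is a maximizer of $L^{\rm b}$ over $\mathbb R^d$ whenever the observed data admit one (and is arbitrary otherwise). Its information matrix is $I_{\rm b}(\boldsymbol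 b,\zeta)=-\partial^2\log L^{\rm b}(\boldsymbol b)/\partial\boldsymbol b\,\partial\boldsymbol b^{\rm T}=\sum_{t\in\Omega}\mathcal V(\boldsymbol b,t)\,dN(t)$, where $\mathcal V(\boldsymbol b,t)=\sum_{i\le n} q_i(\boldsymbol x_i-\epsilon)(\boldsymbol x_i-\epsilon)^{\rm T}$, $\epsilon=\sum_{i\le n} q_i\boldsymbol x_i$, $q_i=Y_i(t)e^{\boldsymbol x_i^{\rm T}\boldsymbol b}/\sum_{l\le n}Y_l(t)e^{\boldsymbol x_l^{\rm T}\boldsymbol b}$. **Assumptions.** 1. $\Pr(n(\zeta)-d(\zeta)\ge1)\to1$. 2. All $\boldsymbol x_i$ lie in one compact set. 3. $\sup_{t\in\Omega}d\Lambda_0^*(t)=\mathcal O(\tau)$. 4. There is $y$ with $y(t)\in(0,1]$ for $t\in[0,\zeta]$ and $\sup_{t\in[0,\zeta]}|n(t)/n-y(t)|\to0$ almost surely. 5. $\sup_{t\in\Omega}dN(t)=\mathcal O_{\rm P}\big(\sup_{t\in\Omega}\mathrm E(dN(t)\mid\mathcal F_{t^-})\big)$. 6. $\mathrm E(dN_i(t)dN_l(t)\mid\mathcal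 F_{t^-})=\mathrm E(dN_i(t)\mid\mathcal F_{t^-})\,\mathrm E(dN_l(t)\mid\mathcal F_{t^-})$ a.s. for $i\ne l$ and $t\in[0,\zeta]$. 7. Let $S^{(0)}(\boldsymbol b,t)=\sum_{i\le n} Y_i(t)e^{\boldsymbol x_i^{\rm T}\boldsymbol b}$, $S^{(1)}(\boldsymbol b,t)=\sum_{i\le n} Y_i(t)\boldsymbol x_ie^{\boldsymbol x_i^{\rm T}\boldsymbol b}$, $S^{(2)}(\boldsymbol b,t)=\sum_{i\le n} Y_i(t)\boldsymbol x_i\boldsymbol x_i^{\rm T}e^{\boldsymbol x_i^{\rm T}\boldsymbol b}$. There are an open convex neighbourhood $\mathcal B$ of $\boldsymbol\beta$ and functions $s^{(0)},s^{(1)},s^{(2)}$ on $\mathcal B\times[0,\zeta]$ such that: $\Lambda_0(\zeta)<\infty$; $\sup_{\boldsymbol b\in\mathcal B,t\in[0,\zeta]}\|S^{(j)}(\boldsymbol b,t)/n-s^{(j)}(\boldsymbol b,t)\|_\infty\to0$ in probability for $j=0,1,2$; $s^{(0)}$ is bounded below by a positive constant and $s^{(0)},s^{(1)},s^{(2)}$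 are bounded; each $s^{(j)}(\boldsymbol b,t)$ is continuous in $\boldsymbol b\in\mathcal B$ uniformly in $t\in[0,\zeta]$; $s^{(1)}$ and $s^{(2)}$ are the gradient and the Hessian matrix of $s^{(0)}$ in $\boldsymbol b$; and $$\Sigma(\boldsymbol b,\zeta)=\int_0^\zeta\Big\{\frac{s^{(2)}}{s^{(0)}}-\frac{s^{(1)}}{s^{(0)}}\Big(\frac{s^{(1)}}{s^{(0)}}\Big)^{\rm T}\Big\}(\boldsymbol b,t)\,s^{(0)}(\boldsymbol b,t)\,d\Lambda_0(t)$$ is positive definite for every $\boldsymbol b\in\mathcal B$. **Theorem.** Under Assumptions 1–7, if $\tau\to0$ as $n\to\infty$, then $\widehat{\boldsymbol\beta}_{\rm b}\to\boldsymbol\beta$ in probability and $I_{\rm b}(\widehat{\boldsymbol\beta}_{\rm b},\zeta)/n\to\Sigma(\boldsymbol\beta,\zeta)$ in probability. Moreover, the numbers of ties satisfy $\sup_{t\in\Omega}d(t)=\mathcal O_{\rm P}(n\tau)$. -/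

import Mathlib

open MeasureTheory ProbabilityTheory Filter Topology Asymptotics
open scoped ENNReal NNReal Matrix

-- Matrices carry the entrywise maximum norm; vectors `Fin d → ℝ` carry the maximum norm.
attribute [local instance] Matrix.normedAddCommGroup

/-- The continuous-time Cox proportional hazards model with independent right censoring for an
infinite sequence of subjects (subject `i` is the `(i+1)`-st one; a sample of size `n` consists of
the subjects `i < n`), with deterministic covariates. -/
structure CoxModel {Ω : Type*} [MeasurableSpace Ω] (P : Measure Ω) (d : ℕ) where
  /-- the true regression coefficients -/
  β : Fin d → ℝ
  /-- the covariates -/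
  x : ℕ → Fin d → ℝ
  /-- the baseline hazard rate -/
  lam0 : ℝ → ℝ≥0
  /-- the end of the study -/
  ζ : ℝ
  /-- the underlying event times -/
  T : ℕ → Ω → ℝ
  /-- the underlying censoring times -/
  C : ℕ → Ω → ℝ
  measurable_lam0 : Measurable lam0
  ζ_pos : 0 < ζ
  measurable_T : ∀ i, Measurable (T i)
  measurable_C : ∀ i, Measurable (C i)
  T_pos : ∀ i ω, 0 < T i ω
  C_mem : ∀ i ω, C i ω ∈ Set.Ioc 0 ζ
  /-- `Pr(T_i > t) = exp(-exp(x_iᵀβ) Λ₀(t))` with `Λ₀(t) = ∫₀ᵗ λ₀ ∈ [0, ∞]` -/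
  survival : ∀ i t, 0 ≤ t →
    P {ω | t < T i ω} =
      if ∫⁻ s in Set.Ioc 0 t, (lam0 s : ℝ≥0∞) = ⊤ then 0
      else ENNReal.ofReal (Real.exp (-(Real.exp (x i ⬝ᵥ β) *
        (∫⁻ s in Set.Ioc 0 t, (lam0 s : ℝ≥0∞)).toReal)))
  indep_T : iIndepFun T P
  indep_C : iIndepFun C P
  indep_T_C : IndepFun (fun ω i => T i ω) (fun ω i => C i ω) P

/-- `X_n = O_P(Y_n)`: for some `K > 0`, `Pr(|X_n| > K |Y_n|) → 0`. -/
def IsBigOP {Ω : Type*} [MeasurableSpace Ω] (P : Measure Ω) (X Y : ℕ → Ω → ℝ) : Prop :=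
  ∃ K : ℝ, 0 < K ∧ Tendsto (fun n => P {ω | K * |Y n ω| < |X n ω|}) atTop (𝓝 0)

namespace CoxModel

noncomputable section

variable {Ω : Type*} [MeasurableSpace Ω] {P : Measure Ω} {d : ℕ} (M : CoxModel P d)

/-! #### The grouped model with grouping parameter `τ` -/

/-- The baseline cumulative hazard `Λ₀(t) = ∫₀ᵗ λ₀(s) ds`. -/
def Lam0 (t : ℝ) : ℝ≥0∞ := ∫⁻ s in Set.Ioc 0 t, (M.lam0 s : ℝ≥0∞)

/-- The set `{τ, 2τ, …, ζ}` of possible observed times (`ζ` being a multiple of `τ`). -/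
def grid (τ : ℝ) : Finset ℝ := (Finset.Icc 1 ⌊M.ζ / τ⌋₊).image (fun k : ℕ => (k : ℝ) * τ)

/-- The grouped baseline hazard `dΛ₀*(t) = Λ₀(t) - Λ₀(t - τ)` at a multiple `t ≥ τ` of `τ`. -/
def dLam0Star (τ t : ℝ) : ℝ := (M.Lam0 t).toReal - (M.Lam0 (t - τ)).toReal

/-- The grouped event time. -/
def TStar (τ : ℝ) (i : ℕ) (ω : Ω) : ℝ := τ * (⌈M.T i ω / τ⌉ : ℝ)

/-- The grouped censoring time. -/
def CStar (τ : ℝ) (i : ℕ) (ω : Ω) : ℝ := τ * (⌈M.C i ω / τ⌉ : ℝ)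

/-- The observed time. -/
def TObs (τ : ℝ) (i : ℕ) (ω : Ω) : ℝ := min (M.TStar τ i ω) (M.CStar τ i ω)

/-- The event indicator `δ_i = 1`. -/
def IsEvent (τ : ℝ) (i : ℕ) (ω : Ω) : Prop := M.TStar τ i ω ≤ M.CStar τ i ω

open Classical in
/-- The set of the subjects that have an event at time `t`. -/
def eventSet (τ : ℝ) (n : ℕ) (t : ℝ) (ω : Ω) : Finset ℕ :=
  (Finset.range n).filter (fun i => M.TObs τ i ω = t ∧ M.IsEvent τ i ω)

open Classical in
/-- The set of the subjects at risk at time `t`. -/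
def riskSet (τ : ℝ) (n : ℕ) (t : ℝ) (ω : Ω) : Finset ℕ :=
  (Finset.range n).filter (fun i => t ≤ M.TObs τ i ω)

/-- The number `d(t)` of events at time `t`. -/
def numEvents (τ : ℝ) (n : ℕ) (t : ℝ) (ω : Ω) : ℕ := (M.eventSet τ n t ω).card

/-- The number `n(t)` of subjects at risk at time `t`. -/
def numAtRisk (τ : ℝ) (n : ℕ) (t : ℝ) (ω : Ω) : ℕ := (M.riskSet τ n t ω).card

open Classical in
/-- The observed counting process `N_i(t)`. -/
def N (τ : ℝ) (i : ℕ) (t : ℝ) (ω : Ω) : ℝ :=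
  if M.TObs τ i ω ≤ t ∧ M.IsEvent τ i ω then 1 else 0

open Classical in
/-- The at-risk process `Y_i(t)`. -/
def Y (τ : ℝ) (i : ℕ) (t : ℝ) (ω : Ω) : ℝ := if t ≤ M.TObs τ i ω then 1 else 0

open Classical in
/-- The jump `dN_i(t) = N_i(t) - N_i(t⁻)`; see `dN_eq_sub_leftLim`. -/
def dN (τ : ℝ) (i : ℕ) (t : ℝ) (ω : Ω) : ℝ :=
  if M.TObs τ i ω = t ∧ M.IsEvent τ i ω then 1 else 0

/-- The jump `dN(t) = ∑ i, dN_i(t)` of the aggregated process. -/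
def dNsum (τ : ℝ) (n : ℕ) (t : ℝ) (ω : Ω) : ℝ := ∑ i ∈ Finset.range n, M.dN τ i t ω

/-- The history just before `t`: the σ-algebra generated by `N_i(u)`, `Y_i(u)`, `i < n`,
`0 ≤ u < t`. -/
abbrev histBefore (τ : ℝ) (n : ℕ) (t : ℝ) : MeasurableSpace Ω :=
  ⨆ i ∈ Finset.range n, ⨆ u ∈ Set.Ico 0 t,
    MeasurableSpace.comap (M.N τ i u) inferInstance ⊔
      MeasurableSpace.comap (M.Y τ i u) inferInstance

/-! #### The Breslow partial likelihood, its maximizer and its information matrix -/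

/-- The Breslow partial likelihood component at time `t`. -/
def breslowTerm (τ : ℝ) (n : ℕ) (ω : Ω) (b : Fin d → ℝ) (t : ℝ) : ℝ :=
  Real.exp (∑ i ∈ M.eventSet τ n t ω, M.x i ⬝ᵥ b) /
    ((∑ i ∈ M.riskSet τ n t ω, Real.exp (M.x i ⬝ᵥ b)) ^ M.numEvents τ n t ω /
      ((M.numEvents τ n t ω).factorial : ℝ))

/-- The Breslow partial likelihood of the whole study, a function of the coefficients `b`. -/
def breslowLik (τ : ℝ) (n : ℕ) (ω : Ω) (b : Fin d → ℝ) : ℝ :=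
  ∏ t ∈ M.grid τ, M.breslowTerm τ n ω b t

/-- `βhat` is a Breslow estimator for grouping parameters `τ n`: at each sample of each size it is
a maximizer over `ℝ^d` of the Breslow partial likelihood whenever there is a maximizer. (Data in
which there is none have positive probability; the value at such data is arbitrary.) -/
def IsBreslowEstimator (τ : ℕ → ℝ) (βhat : ℕ → Ω → Fin d → ℝ) : Prop :=
  ∀ n ω, (∃ b, IsMaxOn (M.breslowLik (τ n) n ω) Set.univ b) →
    IsMaxOn (M.breslowLik (τ n) n ω) Set.univ (βhat n ω)

/-- `S⁽⁰⁾(b, t)` -/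
def S0 (τ : ℝ) (n : ℕ) (ω : Ω) (b : Fin d → ℝ) (t : ℝ) : ℝ :=
  ∑ i ∈ Finset.range n, M.Y τ i t ω * Real.exp (M.x i ⬝ᵥ b)

/-- `S⁽¹⁾(b, t)` -/
def S1 (τ : ℝ) (n : ℕ) (ω : Ω) (b : Fin d → ℝ) (t : ℝ) : Fin d → ℝ :=
  ∑ i ∈ Finset.range n, (M.Y τ i t ω * Real.exp (M.x i ⬝ᵥ b)) • M.x i

/-- `S⁽²⁾(b, t)` -/
def S2 (τ : ℝ) (n : ℕ) (ω : Ω) (b : Fin d → ℝ) (t : ℝ) : Matrix (Fin d) (Fin d) ℝ :=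
  ∑ i ∈ Finset.range n,
    (M.Y τ i t ω * Real.exp (M.x i ⬝ᵥ b)) • Matrix.vecMulVec (M.x i) (M.x i)

/-- The weight `q_i(b, t)` of subject `i`. -/
def q (τ : ℝ) (n : ℕ) (ω : Ω) (b : Fin d → ℝ) (t : ℝ) (i : ℕ) : ℝ :=
  M.Y τ i t ω * Real.exp (M.x i ⬝ᵥ b) / M.S0 τ n ω b t

/-- The weighted mean of the covariates. -/
def qMean (τ : ℝ) (n : ℕ) (ω : Ω) (b : Fin d → ℝ) (t : ℝ) : Fin d → ℝ :=
  ∑ i ∈ Finset.range n, M.q τ n ω b t i • M.x i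

/-- The weighted covariance matrix of the covariates. -/
def qCov (τ : ℝ) (n : ℕ) (ω : Ω) (b : Fin d → ℝ) (t : ℝ) : Matrix (Fin d) (Fin d) ℝ :=
  ∑ i ∈ Finset.range n, M.q τ n ω b t i •
    Matrix.vecMulVec (M.x i - M.qMean τ n ω b t) (M.x i - M.qMean τ n ω b t)

/-- The information matrix at the end of the study, that is, the negative Hessian matrix of the
logarithm of the Breslow partial likelihood; see `hessian_log_breslowLik`. -/
def infoMatrix (τ : ℝ) (n : ℕ) (ω : Ω) (b : Fin d → ℝ) : Matrix (Fin d) (Fin d) ℝ :=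
  ∑ t ∈ M.grid τ, M.dNsum τ n t ω • M.qCov τ n ω b t

/-- `dN` is the jump of `N`. -/
theorem dN_eq_sub_leftLim (τ : ℝ) (i : ℕ) (t : ℝ) (ω : Ω) :
    M.dN τ i t ω = M.N τ i t ω - Function.leftLim (fun u => M.N τ i u ω) t := by
  classical
  have key : Function.leftLim (fun u => M.N τ i u ω) t =
      if M.TObs τ i ω < t ∧ M.IsEvent τ i ω then 1 else 0 := by
    apply leftLim_eq_of_tendsto
    apply tendsto_const_nhds.congr'
    by_cases h : M.TObs τ i ω < t
    · filter_upwards [Ioo_mem_nhdsLT h] with u hu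
      simp [N, h, hu.1.le]
    · filter_upwards [self_mem_nhdsWithin] with u hu
      have : ¬ M.TObs τ i ω ≤ u := fun h' => h (lt_of_le_of_lt h' hu)
      simp [N, h, this]
  rw [key]
  unfold dN N
  by_cases hE : M.IsEvent τ i ω
  · rcases lt_trichotomy (M.TObs τ i ω) t with h | h | h
    · simp [h, h.le, h.ne, hE]
    · simp [h, hE]
    · simp [h.ne', not_le.2 h, not_lt.2 h.le, hE]
  · simp [hE]

theorem numEvents_cast (τ : ℝ) (n : ℕ) (t : ℝ) (ω : Ω) :
    (M.numEvents τ n t ω : ℝ) = M.dNsum τ n t ω := by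
  classical
  simp [numEvents, eventSet, dNsum, dN, Finset.sum_boole]

theorem S0_eq (τ : ℝ) (n : ℕ) (ω : Ω) (b : Fin d → ℝ) (t : ℝ) :
    M.S0 τ n ω b t = ∑ i ∈ M.riskSet τ n t ω, Real.exp (M.x i ⬝ᵥ b) := by
  classical
  simp [S0, riskSet, Y, Finset.sum_filter]

theorem S0_pos (τ : ℝ) (n : ℕ) (ω : Ω) (b : Fin d → ℝ) (t : ℝ) (h : M.numEvents τ n t ω ≠ 0) :
    0 < M.S0 τ n ω b t := by
  classical
  rw [S0_eq]
  apply Finset.sum_pos (fun i _ => Real.exp_pos _)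
  obtain ⟨i, hi⟩ := Finset.card_pos.1 (Nat.pos_of_ne_zero h)
  refine ⟨i, ?_⟩
  simp only [eventSet, riskSet, Finset.mem_filter] at hi ⊢
  exact ⟨hi.1, hi.2.1.ge⟩

theorem breslowTerm_pos (τ : ℝ) (n : ℕ) (ω : Ω) (b : Fin d → ℝ) (t : ℝ) :
    0 < M.breslowTerm τ n ω b t := by
  unfold breslowTerm
  rw [← S0_eq]
  by_cases h : M.numEvents τ n t ω = 0
  · simp [h, Real.exp_pos]
  · have := M.S0_pos τ n ω b t h
    positivity

theorem log_breslowTerm (τ : ℝ) (n : ℕ) (ω : Ω) (b : Fin d → ℝ) (t : ℝ) :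
    Real.log (M.breslowTerm τ n ω b t) = (∑ i ∈ M.eventSet τ n t ω, M.x i ⬝ᵥ b) -
      M.numEvents τ n t ω * Real.log (M.S0 τ n ω b t) +
        Real.log ((M.numEvents τ n t ω).factorial) := by
  unfold breslowTerm
  rw [← S0_eq]
  by_cases h : M.numEvents τ n t ω = 0
  · simp [h]
  · have := M.S0_pos τ n ω b t h
    rw [Real.log_div (Real.exp_pos _).ne' (by positivity), Real.log_div (by positivity)
      (by positivity), Real.log_exp, Real.log_pow]
    ring

/-- The linear form `b ↦ x_iᵀ b`. -/
def dotCLM (i : ℕ) : (Fin d → ℝ) →L[ℝ] ℝ := LinearMap.toContinuousLinearMap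
  { toFun := fun b => M.x i ⬝ᵥ b
    map_add' := fun _ _ => dotProduct_add _ _ _
    map_smul' := fun _ _ => dotProduct_smul _ _ _ }

theorem hasFDerivAt_exp (i : ℕ) (b : Fin d → ℝ) :
    HasFDerivAt (fun b' => Real.exp (M.x i ⬝ᵥ b')) (Real.exp (M.x i ⬝ᵥ b) • M.dotCLM i) b :=
  ((M.dotCLM i).hasFDerivAt (x := b)).exp

theorem hasFDerivAt_S0 (τ : ℝ) (n : ℕ) (ω : Ω) (b : Fin d → ℝ) (t : ℝ) :
    HasFDerivAt (fun b' => M.S0 τ n ω b' t) (∑ i ∈ Finset.range n,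
      M.Y τ i t ω • Real.exp (M.x i ⬝ᵥ b) • M.dotCLM i) b :=
  HasFDerivAt.fun_sum fun i _ => (M.hasFDerivAt_exp i b).const_mul _

theorem hasFDerivAt_S1 (τ : ℝ) (n : ℕ) (ω : Ω) (b : Fin d → ℝ) (t : ℝ) (l : Fin d) :
    HasFDerivAt (fun b' => M.S1 τ n ω b' t l) (∑ i ∈ Finset.range n,
      M.x i l • M.Y τ i t ω • Real.exp (M.x i ⬝ᵥ b) • M.dotCLM i) b := by
  have h : (fun b' => M.S1 τ n ω b' t l) = fun b' => ∑ i ∈ Finset.range n,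
      (M.Y τ i t ω * Real.exp (M.x i ⬝ᵥ b')) * M.x i l := by
    funext b'
    simp [S1, Finset.sum_apply]
  rw [h]
  exact HasFDerivAt.fun_sum fun i _ => ((M.hasFDerivAt_exp i b).const_mul _).mul_const _

theorem dotCLM_single (i : ℕ) (l : Fin d) : M.dotCLM i (Pi.single l 1) = M.x i l := by
  simp [dotCLM]

theorem qMean_eq (τ : ℝ) (n : ℕ) (ω : Ω) (b : Fin d → ℝ) (t : ℝ) (l : Fin d) :
    M.qMean τ n ω b t l = M.S1 τ n ω b t l / M.S0 τ n ω b t := by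
  simp only [qMean, q, S1, Finset.sum_apply, Pi.smul_apply, smul_eq_mul, Finset.sum_div]
  exact Finset.sum_congr rfl fun i _ => by ring

theorem qCov_eq (τ : ℝ) (n : ℕ) (ω : Ω) (b : Fin d → ℝ) (t : ℝ) (k l : Fin d)
    (h : M.S0 τ n ω b t ≠ 0) :
    M.qCov τ n ω b t k l = M.S2 τ n ω b t k l / M.S0 τ n ω b t -
      M.S1 τ n ω b t k / M.S0 τ n ω b t * (M.S1 τ n ω b t l / M.S0 τ n ω b t) := by
  have hq : ∑ i ∈ Finset.range n, M.q τ n ω b t i = 1 := by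
    simp only [q, ← Finset.sum_div]
    exact div_self h
  have hk : ∀ l, ∑ i ∈ Finset.range n, M.q τ n ω b t i * M.x i l = M.qMean τ n ω b t l := by
    intro l
    simp [qMean, Finset.sum_apply]
  have h2 : M.S2 τ n ω b t k l / M.S0 τ n ω b t =
      ∑ i ∈ Finset.range n, M.q τ n ω b t i * (M.x i k * M.x i l) := by
    simp only [S2, q, Matrix.sum_apply, Matrix.smul_apply, Matrix.vecMulVec_apply, smul_eq_mul,
      Finset.sum_div]
    exact Finset.sum_congr rfl fun i _ => by ring
  rw [h2, ← qMean_eq, ← qMean_eq]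
  have : M.qCov τ n ω b t k l = ∑ i ∈ Finset.range n, (M.q τ n ω b t i * (M.x i k * M.x i l)
      - M.q τ n ω b t i * M.x i k * M.qMean τ n ω b t l
      - M.q τ n ω b t i * M.x i l * M.qMean τ n ω b t k
      + M.q τ n ω b t i * (M.qMean τ n ω b t k * M.qMean τ n ω b t l)) := by
    simp only [qCov, Matrix.sum_apply, Matrix.smul_apply, Matrix.vecMulVec_apply, smul_eq_mul,
      Pi.sub_apply]
    exact Finset.sum_congr rfl fun i _ => by ring
  rw [this, Finset.sum_add_distrib, Finset.sum_sub_distrib, Finset.sum_sub_distrib,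
    ← Finset.sum_mul, ← Finset.sum_mul, ← Finset.sum_mul, hk, hk, hq]
  ring

/-- `infoMatrix` is the negative Hessian matrix of the log partial likelihood. -/
theorem hessian_log_breslowLik (τ : ℝ) (n : ℕ) (ω : Ω) (b : Fin d → ℝ) (k l : Fin d) :
    M.infoMatrix τ n ω b k l =
      -fderiv ℝ (fun b' => fderiv ℝ (fun b'' => Real.log (M.breslowLik τ n ω b'')) b'
        (Pi.single l 1)) b (Pi.single k 1) := by
  have hlog : (fun b'' => Real.log (M.breslowLik τ n ω b'')) = fun b'' => ∑ t ∈ M.grid τ,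
      ((∑ i ∈ M.eventSet τ n t ω, M.dotCLM i b'') -
      M.numEvents τ n t ω * Real.log (M.S0 τ n ω b'' t) +
        Real.log ((M.numEvents τ n t ω).factorial)) := by
    funext b''
    unfold breslowLik
    rw [Real.log_prod fun t _ => (M.breslowTerm_pos τ n ω b'' t).ne']
    exact Finset.sum_congr rfl fun t _ => M.log_breslowTerm τ n ω b'' t
  have hlogS : ∀ b' t, HasFDerivAt
      (fun b'' => (M.numEvents τ n t ω : ℝ) * Real.log (M.S0 τ n ω b'' t))
      ((M.numEvents τ n t ω : ℝ) • (M.S0 τ n ω b' t)⁻¹ • ∑ i ∈ Finset.range n,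
        M.Y τ i t ω • Real.exp (M.x i ⬝ᵥ b') • M.dotCLM i) b' := by
    intro b' t
    by_cases h : M.numEvents τ n t ω = 0
    · simpa [h] using hasFDerivAt_const (0 : ℝ) b'
    · exact ((M.hasFDerivAt_S0 τ n ω b' t).log (M.S0_pos τ n ω b' t h).ne').const_mul _
  have hgrad : (fun b' => fderiv ℝ (fun b'' => Real.log (M.breslowLik τ n ω b'')) b'
        (Pi.single l 1)) = fun b' => ∑ t ∈ M.grid τ, ((∑ i ∈ M.eventSet τ n t ω, M.x i l) -
          M.numEvents τ n t ω * (M.S1 τ n ω b' t l * (M.S0 τ n ω b' t)⁻¹)) := by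
    funext b'
    rw [hlog]
    have := HasFDerivAt.fun_sum (u := M.grid τ) fun t _ =>
      (((HasFDerivAt.fun_sum (u := M.eventSet τ n t ω) fun i _ =>
        (M.dotCLM i).hasFDerivAt (x := b')).fun_sub (hlogS b' t)).add_const
          (Real.log ((M.numEvents τ n t ω).factorial)))
    rw [HasFDerivAt.fderiv this]
    simp only [_root_.sum_apply, _root_.sub_apply,
      smul_apply, dotCLM_single, smul_eq_mul]
    refine Finset.sum_congr rfl fun t _ => ?_
    have : M.S1 τ n ω b' t l = ∑ i ∈ Finset.range n,
        M.Y τ i t ω * (Real.exp (M.x i ⬝ᵥ b') * M.x i l) := by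
      simp [S1, Finset.sum_apply, mul_assoc]
    rw [this]
    ring
  have hH : ∀ t, HasFDerivAt (fun b' => (M.numEvents τ n t ω : ℝ) *
      (M.S1 τ n ω b' t l * (M.S0 τ n ω b' t)⁻¹))
      ((M.numEvents τ n t ω : ℝ) • (M.S1 τ n ω b t l • (-((M.S0 τ n ω b t ^ 2)⁻¹) •
        ∑ i ∈ Finset.range n, M.Y τ i t ω • Real.exp (M.x i ⬝ᵥ b) • M.dotCLM i) +
        (M.S0 τ n ω b t)⁻¹ • ∑ i ∈ Finset.range n,
          M.x i l • M.Y τ i t ω • Real.exp (M.x i ⬝ᵥ b) • M.dotCLM i)) b := by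
    intro t
    by_cases h : M.numEvents τ n t ω = 0
    · simpa [h] using hasFDerivAt_const (0 : ℝ) b
    · exact ((M.hasFDerivAt_S1 τ n ω b t l).mul ((hasDerivAt_inv
        (M.S0_pos τ n ω b t h).ne').comp_hasFDerivAt b (M.hasFDerivAt_S0 τ n ω b t))).const_mul _
  rw [hgrad, HasFDerivAt.fderiv (HasFDerivAt.fun_sum (u := M.grid τ) fun t _ =>
    ((hasFDerivAt_const (∑ i ∈ M.eventSet τ n t ω, M.x i l) b).fun_sub (hH t)))]
  simp only [_root_.sum_apply, _root_.sub_apply,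
    smul_apply, add_apply, dotCLM_single, smul_eq_mul,
    zero_apply, infoMatrix, Matrix.sum_apply, Matrix.smul_apply,
    ← Finset.sum_neg_distrib]
  refine Finset.sum_congr rfl fun t _ => ?_
  rw [← numEvents_cast]
  by_cases h : M.numEvents τ n t ω = 0
  · simp [h]
  have hp := (M.S0_pos τ n ω b t h).ne'
  rw [qCov_eq _ _ _ _ _ _ _ _ hp]
  have e1 : M.S1 τ n ω b t k = ∑ i ∈ Finset.range n,
      M.Y τ i t ω * (Real.exp (M.x i ⬝ᵥ b) * M.x i k) := by
    simp [S1, Finset.sum_apply, mul_assoc]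
  have e2 : M.S2 τ n ω b t k l = ∑ i ∈ Finset.range n,
      M.x i l * (M.Y τ i t ω * (Real.exp (M.x i ⬝ᵥ b) * M.x i k)) := by
    simp only [S2, Matrix.sum_apply, Matrix.smul_apply, Matrix.vecMulVec_apply, smul_eq_mul]
    exact Finset.sum_congr rfl fun i _ => by ring
  rw [← e1, ← e2]
  field_simp
  ring

/-! #### The assumptions -/

/-- The grouping parameters are positive and the end of the study is a multiple of each. -/
def IsGrouping (τ : ℕ → ℝ) : Prop :=
  ∀ n, 0 < τ n ∧ ∃ m : ℕ, M.ζ = m * τ n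

/-- `n(ζ) - d(ζ) ≥ 1`, with probability tending to one. -/
def SurvivorsAtEnd (τ : ℕ → ℝ) : Prop :=
  Tendsto (fun n => P {ω | M.numEvents (τ n) n M.ζ ω + 1 ≤ M.numAtRisk (τ n) n M.ζ ω})
    atTop (𝓝 1)

/-- The covariates lie in a compact set. -/
def CompactCovariates : Prop :=
  ∃ K : Set (Fin d → ℝ), IsCompact K ∧ ∀ i, M.x i ∈ K

/-- `sup_t dΛ₀*(t) = O(τ)`. -/
def HazardOrder (τ : ℕ → ℝ) : Prop :=
  (fun n => ⨆ t : M.grid (τ n), M.dLam0Star (τ n) t) =O[atTop] τ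

/-- `sup_{t ∈ [0, ζ]} |n(t)/n - y(t)| → 0` almost surely, with `y(t) ∈ (0, 1]`. -/
def RiskFraction (τ : ℕ → ℝ) : Prop :=
  ∃ y : ℝ → ℝ, (∀ t ∈ Set.Icc 0 M.ζ, y t ∈ Set.Ioc 0 1) ∧
    ∀ᵐ ω ∂P, TendstoUniformlyOn (fun (n : ℕ) t => (M.numAtRisk (τ n) n t ω : ℝ) / n) y atTop
      (Set.Icc 0 M.ζ)

/-- `sup_t dN(t) = O_P(sup_t E(dN(t) | F_{t⁻}))`. -/
def TieOrder (τ : ℕ → ℝ) : Prop :=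
  IsBigOP P (fun n ω => ⨆ t : M.grid (τ n), M.dNsum (τ n) n t ω)
    (fun n ω => ⨆ t : M.grid (τ n), (P[M.dNsum (τ n) n t | M.histBefore (τ n) n t]) ω)

/-- `E(dN_i(t) dN_l(t) | F_{t⁻}) = E(dN_i(t) | F_{t⁻}) E(dN_l(t) | F_{t⁻})` for `i ≠ l`. -/
def CondUncorrelated (τ : ℕ → ℝ) : Prop :=
  ∀ n, ∀ i < n, ∀ l < n, i ≠ l → ∀ t ∈ Set.Icc 0 M.ζ,
    P[fun ω => M.dN (τ n) i t ω * M.dN (τ n) l t ω | M.histBefore (τ n) n t] =ᵐ[P]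
      fun ω => (P[M.dN (τ n) i t | M.histBefore (τ n) n t]) ω *
        (P[M.dN (τ n) l t | M.histBefore (τ n) n t]) ω

/-- `v(b, t) = s⁽²⁾/s⁽⁰⁾ - e eᵀ` with `e = s⁽¹⁾/s⁽⁰⁾`. -/
def limitCov (s0 : (Fin d → ℝ) → ℝ → ℝ) (s1 : (Fin d → ℝ) → ℝ → Fin d → ℝ)
    (s2 : (Fin d → ℝ) → ℝ → Matrix (Fin d) (Fin d) ℝ) (b : Fin d → ℝ) (t : ℝ) :
    Matrix (Fin d) (Fin d) ℝ :=
  (s0 b t)⁻¹ • s2 b t - Matrix.vecMulVec ((s0 b t)⁻¹ • s1 b t) ((s0 b t)⁻¹ • s1 b t)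

/-- `Σ(b, ζ) = ∫₀^ζ v(b, t) s⁽⁰⁾(b, t) dΛ₀(t)`. -/
def Sigma (s0 : (Fin d → ℝ) → ℝ → ℝ) (s1 : (Fin d → ℝ) → ℝ → Fin d → ℝ)
    (s2 : (Fin d → ℝ) → ℝ → Matrix (Fin d) (Fin d) ℝ) (b : Fin d → ℝ) :
    Matrix (Fin d) (Fin d) ℝ :=
  Matrix.of fun k l => ∫ t in Set.Ioc 0 M.ζ, limitCov s0 s1 s2 b t k l * s0 b t * (M.lam0 t : ℝ)

/-- `sup_{b ∈ B, t ∈ [0, ζ]} ‖S_n(b, t)/n - s(b, t)‖ → 0` in probability. -/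
def UniformLimitInProb {E : Type*} [NormedAddCommGroup E] [Module ℝ E]
    (B : Set (Fin d → ℝ)) (S : ℕ → Ω → (Fin d → ℝ) → ℝ → E) (s : (Fin d → ℝ) → ℝ → E) : Prop :=
  ∀ ε : ℝ, 0 < ε → Tendsto
    (fun n : ℕ => P {ω | ∃ b ∈ B, ∃ t ∈ Set.Icc 0 M.ζ, ε < ‖(n : ℝ)⁻¹ • S n ω b t - s b t‖})
    atTop (𝓝 0)

/-- The regularity conditions on the limits `s⁽ʲ⁾` of `S⁽ʲ⁾/n` on the neighbourhood `B` of `β`. -/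
structure RegularLimits (τ : ℕ → ℝ) (B : Set (Fin d → ℝ)) (s0 : (Fin d → ℝ) → ℝ → ℝ)
    (s1 : (Fin d → ℝ) → ℝ → Fin d → ℝ) (s2 : (Fin d → ℝ) → ℝ → Matrix (Fin d) (Fin d) ℝ) :
    Prop where
  isOpen : IsOpen B
  convex : Convex ℝ B
  mem : M.β ∈ B
  hazard_finite : M.Lam0 M.ζ < ⊤
  limit0 : M.UniformLimitInProb B (fun n ω => M.S0 (τ n) n ω) s0
  limit1 : M.UniformLimitInProb B (fun n ω => M.S1 (τ n) n ω) s1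
  limit2 : M.UniformLimitInProb B (fun n ω => M.S2 (τ n) n ω) s2
  lower : ∃ m : ℝ, 0 < m ∧ ∀ b ∈ B, ∀ t ∈ Set.Icc 0 M.ζ, m < s0 b t
  upper : ∃ K : ℝ, 0 < K ∧ ∀ b ∈ B, ∀ t ∈ Set.Icc 0 M.ζ,
    ‖s0 b t‖ ≤ K ∧ ‖s1 b t‖ ≤ K ∧ ‖s2 b t‖ ≤ K
  /-- continuity in `b ∈ B`, uniformly in `t ∈ [0, ζ]` -/
  equicont0 : EquicontinuousOn (fun (t : Set.Icc 0 M.ζ) b => s0 b t) B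
  equicont1 : EquicontinuousOn (fun (t : Set.Icc 0 M.ζ) b => s1 b t) B
  equicont2 : EquicontinuousOn (fun (t : Set.Icc 0 M.ζ) b => s2 b t) B
  /-- `s⁽¹⁾` is the gradient of `s⁽⁰⁾` -/
  deriv0 : ∀ b ∈ B, ∀ t ∈ Set.Icc 0 M.ζ, HasFDerivAt (fun b' => s0 b' t)
    (∑ k, s1 b t k • ContinuousLinearMap.proj (R := ℝ) (φ := fun _ : Fin d => ℝ) k) b
  /-- `s⁽²⁾` is the Hessian matrix of `s⁽⁰⁾` -/
  deriv1 : ∀ b ∈ B, ∀ t ∈ Set.Icc 0 M.ζ, ∀ k, HasFDerivAt (fun b' => s1 b' t k)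
    (∑ l, s2 b t k l • ContinuousLinearMap.proj (R := ℝ) (φ := fun _ : Fin d => ℝ) l) b
  posDef : ∀ b ∈ B, (M.Sigma s0 s1 s2 b).PosDef

end

end CoxModel

/-!
The event and censoring times are all independent, so that consistency of the Breslow estimator
can be derived from second-moment bounds for sums over independent subjects, without
continuous-time martingales.

For a weight function `w`, the sums `∑_t w_i(t) (dN_i(t) - p_i(t) Y_i(t))`, where `p_i(t)` is the
conditional event probability of a cell, are bounded, centred and independent across the subjects
`i`. By Chebyshev's inequality their average tends to zero, and `p_i(t)` may be replaced by
`exp(x_iᵀβ) dΛ₀*(t)` because `sup_t dΛ₀*(t) → 0` (`CoxModel.tendsto_compensated`). With `w` equal to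
`x_i - s⁽¹⁾/s⁽⁰⁾` this shows that the score at `β` is `o_P(n)` (`CoxModel.tendsto_score`). With `w`
equal to an entry of the limiting covariance `v` it shows that the information matrix divided by
`n`, at coefficients near `β`, is close to `∑_t v(β, t) s⁽⁰⁾(β, t) dΛ₀*(t)`
(`CoxModel.tendsto_infoMatrix_apply`). These sums converge to the integral `Σ(β, ζ)`: since
`S⁽ʲ⁾(β, ·)/n` is constant on the cells of the grid, its uniform limit `s⁽ʲ⁾(β, ·)` takes at the end
of a cell nearly the same value as at any other point of the cell, and dominated convergence applies
(`CoxModel.tendsto_sum_dLam0Star_mul`).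

A quadratic lower bound for the logarithm of an exponential mean bounds the log likelihood ratio
near `β` by `hᵀU - hᵀI h / 8`, where `U` and `I` are the score and the information matrix at `β`
(`CoxModel.logLikRatio_le`). As `Σ(β, ζ)` is positive definite, the likelihood on a small sphere
around `β` is less than at `β`, with probability tending to one. By Jensen's inequality the same
holds outside the sphere, whence a maximizer exists and every maximizer is close to `β`
(`CoxModel.norm_sub_lt_of_isBreslowEstimator`).

For the ties, the history before `t`, restricted to the event that subject `i` is event-free at the
start of the cell of `t`, is generated by variables that are independent of the event time of `i`
(`CoxModel.exists_otherInfo_inter`). Hence the conditional mean of `dN_i(t)` is at most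
`exp(x_iᵀβ) dΛ₀*(t) = O(τ)`, and that of `dN(t)` is `O(nτ)`.

Throughout, convergence in probability is convergence along the filter `probFilter`.
-/

/-! ### Convergence in probability as convergence along a filter -/

/-- The filter of the events in `ℕ × Ω` whose section at `n` has probability tending to one as
`n → ∞`. Convergence in probability to a constant is convergence along this filter, so that
the algebra of limits applies to it. -/
def probFilter {Ω : Type*} [MeasurableSpace Ω] (P : Measure Ω) : Filter (ℕ × Ω) where
  sets := {s | Tendsto (fun n => P {ω | (n, ω) ∉ s}) atTop (𝓝 0)}
  univ_sets := by simp
  sets_of_superset := by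
    intro s t hs hst
    refine tendsto_of_tendsto_of_tendsto_of_le_of_le tendsto_const_nhds hs (fun _ => zero_le) ?_
    exact fun n => measure_mono fun ω h h' => h (hst h')
  inter_sets := by
    intro s t hs ht
    have h : Tendsto (fun n => P {ω | (n, ω) ∉ s} + P {ω | (n, ω) ∉ t}) atTop (𝓝 0) := by
      simpa using Tendsto.add hs ht
    refine tendsto_of_tendsto_of_tendsto_of_le_of_le tendsto_const_nhds h (fun _ => zero_le) ?_
    refine fun n => (measure_mono ?_).trans (measure_union_le _ _)
    intro ω hω
    by_contra h'
    simp only [Set.mem_union, Set.mem_ofPred_eq, not_or, not_not] at h'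
    exact hω h'

section probFilter

variable {Ω : Type*} [MeasurableSpace Ω] {P : Measure Ω}

theorem eventually_probFilter_iff {p : ℕ × Ω → Prop} :
    (∀ᶠ z in probFilter P, p z) ↔ Tendsto (fun n => P {ω | ¬ p (n, ω)}) atTop (𝓝 0) :=
  Iff.rfl

theorem tendsto_fst_probFilter : Tendsto Prod.fst (probFilter P) atTop := by
  rw [tendsto_atTop]
  intro N
  rw [eventually_probFilter_iff]
  apply tendsto_const_nhds.congr'
  filter_upwards [eventually_ge_atTop N] with n hn
  simp [hn]

/-- A deterministic property that holds with probability tending to one holds eventually. -/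
theorem eventually_atTop_of_probFilter [IsProbabilityMeasure P] {p : ℕ → Prop}
    (h : ∀ᶠ z in probFilter P, p z.1) : ∀ᶠ n in atTop, p n := by
  rw [eventually_probFilter_iff] at h
  filter_upwards [h.eventually (gt_mem_nhds (zero_lt_one (α := ℝ≥0∞)))] with n hn
  by_contra hp
  simp [hp] at hn

theorem tendstoInMeasure_of_tendsto_probFilter {E : Type*} [PseudoEMetricSpace E]
    {X : ℕ → Ω → E} {a : E}
    (h : Tendsto (fun z : ℕ × Ω => X z.1 z.2) (probFilter P) (𝓝 a)) :
    TendstoInMeasure P X atTop (fun _ => a) := by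
  intro ε hε
  have := EMetric.tendsto_nhds.1 h ε hε
  rw [eventually_probFilter_iff] at this
  simpa only [not_lt] using this

/-- Chebyshev's inequality: centred variables converge to zero in probability if their variances
tend to zero. -/
theorem tendsto_probFilter_of_variance [IsProbabilityMeasure P] {X : ℕ → Ω → ℝ} {v : ℕ → ℝ}
    (hX : ∀ᶠ n in atTop, MemLp (X n) 2 P ∧ ∫ ω, X n ω ∂P = 0 ∧ Var[X n; P] ≤ v n)
    (hv : Tendsto v atTop (𝓝 0)) :
    Tendsto (fun z : ℕ × Ω => X z.1 z.2) (probFilter P) (𝓝 0) := by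
  rw [Metric.tendsto_nhds]
  intro ε hε
  rw [eventually_probFilter_iff]
  have h1 : Tendsto (fun n => ENNReal.ofReal (v n / ε ^ 2)) atTop (𝓝 0) := by
    have := ENNReal.tendsto_ofReal (hv.div_const (ε ^ 2))
    simpa using this
  refine tendsto_of_tendsto_of_tendsto_of_le_of_le' tendsto_const_nhds h1
    (Eventually.of_forall fun _ => zero_le) ?_
  filter_upwards [hX] with n hn
  have := meas_ge_le_variance_div_sq hn.1 hε
  simp only [hn.2.1, sub_zero] at this
  simp only [Real.dist_eq, sub_zero, not_lt]
  exact this.trans (ENNReal.ofReal_le_ofReal (by gcongr; exact hn.2.2))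

end probFilter

namespace CoxModel

variable {Ω : Type*} [MeasurableSpace Ω] {P : Measure Ω} {d : ℕ} (M : CoxModel P d)

/-! ### Independence of the event and the censoring times -/

/-- All event times and all censoring times are jointly independent. -/
theorem iIndepFun_sumElim : iIndepFun (Sum.elim M.T M.C) P := by
  rw [iIndepFun_iff_measure_inter_preimage_eq_mul]
  intro S A hA
  have hL : ∀ i ∈ S.toLeft, MeasurableSet (A (Sum.inl i)) :=
    fun i hi => hA _ (Finset.mem_toLeft.1 hi)
  have hR : ∀ i ∈ S.toRight, MeasurableSet (A (Sum.inr i)) :=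
    fun i hi => hA _ (Finset.mem_toRight.1 hi)
  have hset : (⋂ i ∈ S, Sum.elim M.T M.C i ⁻¹' A i) =
      (fun ω i => M.T i ω) ⁻¹' (⋂ i ∈ S.toLeft, (fun f : ℕ → ℝ => f i) ⁻¹' A (Sum.inl i)) ∩
      (fun ω i => M.C i ω) ⁻¹' (⋂ i ∈ S.toRight, (fun f : ℕ → ℝ => f i) ⁻¹' A (Sum.inr i)) := by
    ext ω
    simp [Sum.forall]
  have hprod : ∏ i ∈ S, P (Sum.elim M.T M.C i ⁻¹' A i) =
      (∏ i ∈ S.toLeft, P (M.T i ⁻¹' A (Sum.inl i))) *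
        ∏ i ∈ S.toRight, P (M.C i ⁻¹' A (Sum.inr i)) := by
    conv_lhs => rw [← Finset.toLeft_disjSum_toRight (u := S)]
    rw [Finset.prod_disjSum]
    rfl
  rw [hset, M.indep_T_C.measure_inter_preimage_eq_mul _ _
    (Finset.measurableSet_biInter _ fun i hi => measurable_pi_apply i (hL i hi))
    (Finset.measurableSet_biInter _ fun i hi => measurable_pi_apply i (hR i hi)), hprod,
    ← M.indep_T.measure_inter_preimage_eq_mul S.toLeft (sets := fun i => A (Sum.inl i)) hL,
    ← M.indep_C.measure_inter_preimage_eq_mul S.toRight (sets := fun i => A (Sum.inr i)) hR]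
  simp only [Set.preimage_iInter]
  rfl

theorem measurable_sumElim (j : ℕ ⊕ ℕ) : Measurable (Sum.elim M.T M.C j) := by
  cases j with
  | inl i => exact M.measurable_T i
  | inr i => exact M.measurable_C i

/-- The σ-algebra generated by all the event and censoring times except the event time of
subject `i`. -/
abbrev otherInfo (i : ℕ) : MeasurableSpace Ω :=
  ⨆ j ∈ ({Sum.inl i}ᶜ : Set (ℕ ⊕ ℕ)), MeasurableSpace.comap (Sum.elim M.T M.C j) inferInstance

/-- The σ-algebra generated by the event and the censoring time of subject `i`. -/
abbrev subjectInfo (i : ℕ) : MeasurableSpace Ω :=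
  ⨆ j ∈ ({Sum.inl i, Sum.inr i} : Set (ℕ ⊕ ℕ)),
    MeasurableSpace.comap (Sum.elim M.T M.C j) inferInstance

theorem otherInfo_le (i : ℕ) : M.otherInfo i ≤ ‹MeasurableSpace Ω› :=
  iSup₂_le fun j _ => (M.measurable_sumElim j).comap_le

theorem measurable_C_otherInfo (i j : ℕ) : Measurable[M.otherInfo i] (M.C j) := by
  refine (comap_measurable (M.C j)).mono ?_ le_rfl
  exact le_iSup₂_of_le (Sum.inr j) (by simp) le_rfl

theorem measurable_T_otherInfo {i j : ℕ} (h : j ≠ i) : Measurable[M.otherInfo i] (M.T j) := by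
  refine (comap_measurable (M.T j)).mono ?_ le_rfl
  exact le_iSup₂_of_le (Sum.inl j) (by simp [h]) le_rfl

theorem measurable_T_subjectInfo (i : ℕ) : Measurable[M.subjectInfo i] (M.T i) := by
  refine (comap_measurable (M.T i)).mono ?_ le_rfl
  exact le_iSup₂_of_le (Sum.inl i) (by simp) le_rfl

theorem measurable_C_subjectInfo (i : ℕ) : Measurable[M.subjectInfo i] (M.C i) := by
  refine (comap_measurable (M.C i)).mono ?_ le_rfl
  exact le_iSup₂_of_le (Sum.inr i) (by simp) le_rfl

theorem indep_T_otherInfo (i : ℕ) :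
    Indep (MeasurableSpace.comap (M.T i) inferInstance) (M.otherInfo i) P := by
  have := indep_iSup_of_disjoint (fun j => (M.measurable_sumElim j).comap_le)
    M.iIndepFun_sumElim (S := {Sum.inl i}) (T := {Sum.inl i}ᶜ) disjoint_compl_right
  rw [iSup_singleton] at this
  exact this

theorem indep_subjectInfo {i j : ℕ} (h : i ≠ j) :
    Indep (M.subjectInfo i) (M.subjectInfo j) P := by
  refine indep_iSup_of_disjoint (fun j => (M.measurable_sumElim j).comap_le)
    M.iIndepFun_sumElim ?_
  simp [h.symm]

end CoxModel

namespace CoxModel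

variable {Ω : Type*} [MeasurableSpace Ω] {P : Measure Ω} {d : ℕ} (M : CoxModel P d)

/-! ### The grid and the grouped times -/

theorem sum_grid {τ : ℝ} (hτ : 0 < τ) {m : ℕ} (hm : M.ζ = m * τ) {E : Type*} [AddCommMonoid E]
    (f : ℝ → E) :
    ∑ t ∈ M.grid τ, f t = ∑ k ∈ Finset.range m, f (((k : ℝ) + 1) * τ) := by
  have hfl : ⌊M.ζ / τ⌋₊ = m := by
    rw [hm, mul_div_assoc, div_self hτ.ne', mul_one, Nat.floor_natCast]
  unfold grid
  rw [hfl, Finset.sum_image, Finset.range_eq_Ico, ← Finset.Ico_add_one_right_eq_Icc,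
    ← Finset.sum_Ico_add' (fun k : ℕ => f (k * τ)) 0 m 1]
  · simp
  · intro a _ b _ h
    simpa [hτ.ne'] using h

theorem mem_grid {τ : ℝ} (hτ : 0 < τ) {m : ℕ} (hm : M.ζ = m * τ) {t : ℝ} :
    t ∈ M.grid τ ↔ ∃ k < m, t = ((k : ℝ) + 1) * τ := by
  have hfl : ⌊M.ζ / τ⌋₊ = m := by
    rw [hm, mul_div_assoc, div_self hτ.ne', mul_one, Nat.floor_natCast]
  unfold grid
  rw [hfl]
  simp only [Finset.mem_image, Finset.mem_Icc]
  constructor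
  · rintro ⟨k, hk, rfl⟩
    refine ⟨k - 1, by omega, ?_⟩
    obtain ⟨j, rfl⟩ : ∃ j, k = j + 1 := ⟨k - 1, by omega⟩
    simp
  · rintro ⟨k, hk, rfl⟩
    exact ⟨k + 1, by omega, by simp⟩

theorem mem_Ioc_of_mem_grid {τ : ℝ} (hτ : 0 < τ) {m : ℕ} (hm : M.ζ = m * τ) {t : ℝ}
    (ht : t ∈ M.grid τ) : t ∈ Set.Ioc 0 M.ζ := by
  obtain ⟨k, hk, rfl⟩ := (M.mem_grid hτ hm).1 ht
  refine ⟨by positivity, ?_⟩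
  rw [hm]
  gcongr
  exact_mod_cast hk

/-- A multiple of `τ` is at most `x` rounded up to a multiple of `τ` if and only if the preceding
multiple is less than `x`. -/
theorem succ_mul_le_mul_ceil {τ : ℝ} (hτ : 0 < τ) (k : ℕ) (x : ℝ) :
    ((k : ℝ) + 1) * τ ≤ τ * (⌈x / τ⌉ : ℝ) ↔ k * τ < x := by
  rw [mul_comm τ, mul_le_mul_iff_left₀ hτ, ← lt_div_iff₀ hτ]
  have : ((k : ℝ) + 1 ≤ (⌈x / τ⌉ : ℝ)) ↔ (k : ℤ) + 1 ≤ ⌈x / τ⌉ := by exact_mod_cast Iff.rfl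
  rw [this, Int.add_one_le_iff, Int.lt_ceil]
  simp

theorem Y_eq {τ : ℝ} (hτ : 0 < τ) (k i : ℕ) (ω : Ω) :
    M.Y τ i (((k : ℝ) + 1) * τ) ω =
      (Set.Ioi (k * τ)).indicator 1 (M.T i ω) * (Set.Ioi (k * τ)).indicator 1 (M.C i ω) := by
  classical
  unfold Y TObs TStar CStar
  simp only [le_min_iff, succ_mul_le_mul_ceil hτ]
  by_cases h1 : k * τ < M.T i ω <;> by_cases h2 : k * τ < M.C i ω <;> simp [h1, h2]

theorem dN_eq {τ : ℝ} (hτ : 0 < τ) (k i : ℕ) (ω : Ω) :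
    M.dN τ i (((k : ℝ) + 1) * τ) ω =
      (Set.Ioc (k * τ) (((k : ℝ) + 1) * τ)).indicator 1 (M.T i ω) *
        (Set.Ioi (k * τ)).indicator 1 (M.C i ω) := by
  classical
  have key : (M.TObs τ i ω = ((k : ℝ) + 1) * τ ∧ M.IsEvent τ i ω) ↔
      (M.T i ω ∈ Set.Ioc (k * τ) (((k : ℝ) + 1) * τ) ∧ k * τ < M.C i ω) := by
    have h1 := succ_mul_le_mul_ceil hτ k (M.T i ω)
    have h2 := succ_mul_le_mul_ceil hτ k (M.C i ω)
    have h3 : τ * (⌈M.T i ω / τ⌉ : ℝ) ≤ ((k : ℝ) + 1) * τ ↔ M.T i ω ≤ ((k : ℝ) + 1) * τ := by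
      rw [mul_comm τ, mul_le_mul_iff_left₀ hτ, ← div_le_iff₀ hτ]
      have : ((⌈M.T i ω / τ⌉ : ℝ) ≤ (k : ℝ) + 1) ↔ ⌈M.T i ω / τ⌉ ≤ (k : ℤ) + 1 := by
        exact_mod_cast Iff.rfl
      rw [this, Int.ceil_le]
      simp
    unfold TObs IsEvent TStar CStar
    rw [Set.mem_Ioc, ← h1, ← h2, ← h3]
    constructor
    · rintro ⟨ha, hb⟩
      rw [min_eq_left hb] at ha
      exact ⟨⟨ha.ge, ha.le⟩, ha ▸ hb⟩
    · rintro ⟨⟨ha, hb⟩, hc⟩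
      have he := le_antisymm hb ha
      exact ⟨by rw [he, min_eq_left hc], he ▸ hc⟩
  unfold dN
  simp only [key]
  by_cases h1 : M.T i ω ∈ Set.Ioc (k * τ) (((k : ℝ) + 1) * τ) <;>
    by_cases h2 : k * τ < M.C i ω <;> simp [h1, h2]

theorem dN_nonneg (τ : ℝ) (i : ℕ) (t : ℝ) (ω : Ω) : 0 ≤ M.dN τ i t ω := by
  unfold dN; split_ifs <;> simp

theorem Y_nonneg (τ : ℝ) (i : ℕ) (t : ℝ) (ω : Ω) : 0 ≤ M.Y τ i t ω := by
  unfold Y; split_ifs <;> simp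

theorem Y_le_one (τ : ℝ) (i : ℕ) (t : ℝ) (ω : Ω) : M.Y τ i t ω ≤ 1 := by
  unfold Y; split_ifs <;> simp

theorem dN_le_one (τ : ℝ) (i : ℕ) (t : ℝ) (ω : Ω) : M.dN τ i t ω ≤ 1 := by
  unfold dN; split_ifs <;> simp

theorem dN_mul_Y (τ : ℝ) (i : ℕ) (t : ℝ) (ω : Ω) :
    M.dN τ i t ω * M.Y τ i t ω = M.dN τ i t ω := by
  unfold dN Y; split_ifs with h h' h' <;> simp
  exact h' h.1.ge

theorem dNsum_nonneg (τ : ℝ) (n : ℕ) (t : ℝ) (ω : Ω) : 0 ≤ M.dNsum τ n t ω :=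
  Finset.sum_nonneg fun i _ => M.dN_nonneg τ i t ω

/-- A subject has at most one event. -/
theorem sum_dN_le_one (τ : ℝ) (i : ℕ) (ω : Ω) (s : Finset ℝ) : ∑ t ∈ s, M.dN τ i t ω ≤ 1 := by
  classical
  calc ∑ t ∈ s, M.dN τ i t ω ≤ ∑ t ∈ s, if M.TObs τ i ω = t then 1 else 0 := by
        refine Finset.sum_le_sum fun t _ => ?_
        unfold dN
        split_ifs <;> simp_all
    _ ≤ 1 := by
        rw [Finset.sum_ite_eq]
        split_ifs <;> simp

theorem sum_dNsum_le (τ : ℝ) (n : ℕ) (ω : Ω) (s : Finset ℝ) :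
    ∑ t ∈ s, M.dNsum τ n t ω ≤ n := by
  unfold dNsum
  rw [Finset.sum_comm]
  calc _ ≤ ∑ i ∈ Finset.range n, (1 : ℝ) := Finset.sum_le_sum fun i _ => M.sum_dN_le_one τ i ω s
    _ = n := by simp

/-! ### The grouped hazard -/

theorem Lam0_mono {s t : ℝ} (h : s ≤ t) : M.Lam0 s ≤ M.Lam0 t :=
  lintegral_mono_set (Set.Ioc_subset_Ioc_right h)

theorem dLam0Star_nonneg (hζ : M.Lam0 M.ζ < ⊤) {τ t : ℝ} (hτ : 0 < τ) (ht : t ≤ M.ζ) :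
    0 ≤ M.dLam0Star τ t := by
  unfold dLam0Star
  rw [sub_nonneg]
  exact ENNReal.toReal_mono ((M.Lam0_mono ht).trans_lt hζ).ne (M.Lam0_mono (by linarith))

theorem sum_dLam0Star {τ : ℝ} (hτ : 0 < τ) {m : ℕ} (hm : M.ζ = m * τ) :
    ∑ t ∈ M.grid τ, M.dLam0Star τ t = (M.Lam0 M.ζ).toReal := by
  rw [M.sum_grid hτ hm]
  have : ∀ k : ℕ, M.dLam0Star τ (((k : ℝ) + 1) * τ) =
      (M.Lam0 (((k + 1 : ℕ) : ℝ) * τ)).toReal - (M.Lam0 ((k : ℝ) * τ)).toReal := by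
    intro k
    unfold dLam0Star
    push_cast
    congr 3
    ring_nf
  simp only [this]
  rw [Finset.sum_range_sub (fun k : ℕ => (M.Lam0 ((k : ℝ) * τ)).toReal), ← hm]
  simp [Lam0]

/-- The conditional probability that subject `i`, when at risk, has its event in the cell that
ends at `t`. -/
noncomputable def cellProb (τ : ℝ) (i : ℕ) (t : ℝ) : ℝ :=
  1 - Real.exp (-(Real.exp (M.x i ⬝ᵥ M.β) * M.dLam0Star τ t))

theorem cellProb_nonneg (hζ : M.Lam0 M.ζ < ⊤) {τ t : ℝ} (hτ : 0 < τ) (ht : t ≤ M.ζ) (i : ℕ) :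
    0 ≤ M.cellProb τ i t := by
  have := M.dLam0Star_nonneg hζ hτ ht
  unfold cellProb
  rw [sub_nonneg, Real.exp_le_one_iff]
  have := Real.exp_pos (M.x i ⬝ᵥ M.β)
  nlinarith [mul_nonneg this.le ‹0 ≤ M.dLam0Star τ t›]

theorem cellProb_le (τ : ℝ) (i : ℕ) (t : ℝ) :
    M.cellProb τ i t ≤ Real.exp (M.x i ⬝ᵥ M.β) * M.dLam0Star τ t := by
  unfold cellProb
  linarith [Real.add_one_le_exp (-(Real.exp (M.x i ⬝ᵥ M.β) * M.dLam0Star τ t))]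

theorem le_cellProb (hζ : M.Lam0 M.ζ < ⊤) {τ t : ℝ} (hτ : 0 < τ) (ht : t ≤ M.ζ) (i : ℕ) :
    Real.exp (M.x i ⬝ᵥ M.β) * M.dLam0Star τ t -
      (Real.exp (M.x i ⬝ᵥ M.β) * M.dLam0Star τ t) ^ 2 ≤ M.cellProb τ i t := by
  have h0 := mul_nonneg (Real.exp_pos (M.x i ⬝ᵥ M.β)).le (M.dLam0Star_nonneg hζ hτ ht)
  unfold cellProb
  set a := Real.exp (M.x i ⬝ᵥ M.β) * M.dLam0Star τ t
  -- `exp (-a) ≤ 1 / (1 + a) ≤ 1 - a + a ^ 2`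
  have h1 : Real.exp (-a) * (1 + a) ≤ 1 := by
    calc Real.exp (-a) * (1 + a) ≤ Real.exp (-a) * Real.exp a := by
          gcongr
          linarith [Real.add_one_le_exp a]
      _ = 1 := by rw [← Real.exp_add]; simp
  nlinarith [Real.exp_pos (-a), pow_nonneg h0 3]

theorem measureReal_T_Ioi [IsProbabilityMeasure P] (hζ : M.Lam0 M.ζ < ⊤) (i : ℕ) {t : ℝ}
    (h0 : 0 ≤ t) (ht : t ≤ M.ζ) :
    P.real (M.T i ⁻¹' Set.Ioi t) =
      Real.exp (-(Real.exp (M.x i ⬝ᵥ M.β) * (M.Lam0 t).toReal)) := by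
  have h := M.survival i t h0
  have hfin : M.Lam0 t ≠ ⊤ := ((M.Lam0_mono ht).trans_lt hζ).ne
  unfold Lam0 at hfin
  rw [if_neg hfin] at h
  have : M.T i ⁻¹' Set.Ioi t = {ω | t < M.T i ω} := rfl
  rw [measureReal_def, this, h, ENNReal.toReal_ofReal (Real.exp_pos _).le]
  rfl

theorem measureReal_T_Ioc [IsProbabilityMeasure P] (hζ : M.Lam0 M.ζ < ⊤) (i : ℕ) {τ t : ℝ}
    (hτ : 0 < τ) (h0 : 0 ≤ t - τ) (ht : t ≤ M.ζ) :
    P.real (M.T i ⁻¹' Set.Ioc (t - τ) t) =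
      M.cellProb τ i t * P.real (M.T i ⁻¹' Set.Ioi (t - τ)) := by
  have hsub : M.T i ⁻¹' Set.Ioc (t - τ) t =
      M.T i ⁻¹' Set.Ioi (t - τ) \ M.T i ⁻¹' Set.Ioi t := by
    ext ω; simp [and_comm]
  rw [hsub, measureReal_sdiff _ (M.measurable_T i measurableSet_Ioi),
    M.measureReal_T_Ioi hζ i h0 (by linarith), M.measureReal_T_Ioi hζ i (by linarith) ht]
  · unfold cellProb dLam0Star
    rw [sub_mul, one_mul, ← Real.exp_add]
    congr 2
    ring
  · exact fun ω (h : t < M.T i ω) => (by linarith : t - τ < M.T i ω)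

/-- The martingale property of the centred jumps, in a strong form: the information on the other
subjects and on all the censoring times is available. -/
theorem setIntegral_dN_sub [IsProbabilityMeasure P] (hζ : M.Lam0 M.ζ < ⊤) (i : ℕ) {τ : ℝ}
    (hτ : 0 < τ) {m : ℕ} (hm : M.ζ = m * τ) {t : ℝ} (ht : t ∈ M.grid τ) {A : Set Ω}
    (hA : MeasurableSet[M.otherInfo i] A) :
    ∫ ω in A, (M.dN τ i t ω - M.cellProb τ i t * M.Y τ i t ω) ∂P = 0 := by
  have htζ := (M.mem_Ioc_of_mem_grid hτ hm ht).2
  obtain ⟨k, hk, rfl⟩ := (M.mem_grid hτ hm).1 ht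
  set t := ((k : ℝ) + 1) * τ with ht_def
  have hs : (k : ℝ) * τ = t - τ := by rw [ht_def]; ring
  have hs0 : 0 ≤ t - τ := by rw [← hs]; positivity
  have hT := M.measurable_T i
  set D := A ∩ M.C i ⁻¹' Set.Ioi (t - τ)
  have hD : MeasurableSet[M.otherInfo i] D :=
    hA.inter (M.measurable_C_otherInfo i i measurableSet_Ioi)
  have hind : ∀ U : Set ℝ, MeasurableSet U →
      P.real (M.T i ⁻¹' U ∩ D) = P.real (M.T i ⁻¹' U) * P.real D := by
    intro U hU
    rw [measureReal_def, (Indep_iff _ _ _).1 (M.indep_T_otherInfo i) _ _ ⟨U, hU, rfl⟩ hD,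
      ENNReal.toReal_mul]
    rfl
  have hint : ∀ ω, A.indicator (fun ω => M.dN τ i t ω - M.cellProb τ i t * M.Y τ i t ω) ω =
      (M.T i ⁻¹' Set.Ioc (t - τ) t ∩ D).indicator 1 ω -
        M.cellProb τ i t * (M.T i ⁻¹' Set.Ioi (t - τ) ∩ D).indicator 1 ω := by
    intro ω
    have h1 := M.dN_eq hτ k i ω
    have h2 := M.Y_eq hτ k i ω
    rw [← ht_def, hs] at h1 h2
    by_cases hω : ω ∈ A
    · rw [Set.indicator_of_mem hω, h1, h2]
      have e : ∀ U : Set ℝ, (M.T i ⁻¹' U ∩ D).indicator (1 : Ω → ℝ) ω =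
          U.indicator 1 (M.T i ω) * (Set.Ioi (t - τ)).indicator 1 (M.C i ω) := by
        intro U
        by_cases a : M.T i ω ∈ U <;> by_cases b : t - τ < M.C i ω <;>
          simp [D, a, b, hω, Set.indicator]
      rw [e, e]
    · have : ω ∉ D := fun h => hω h.1
      simp [hω, this]
  have hAm : MeasurableSet A := M.otherInfo_le i _ hA
  have hDm : MeasurableSet D := M.otherInfo_le i _ hD
  rw [← integral_indicator hAm]
  simp only [hint]
  have hI : ∀ U : Set ℝ, MeasurableSet U →
      Integrable ((M.T i ⁻¹' U ∩ D).indicator (1 : Ω → ℝ)) P := fun U hU =>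
    (integrable_const (1 : ℝ)).indicator ((hT hU).inter hDm)
  rw [integral_sub (hI _ measurableSet_Ioc) ((hI _ measurableSet_Ioi).const_mul _),
    integral_const_mul, integral_indicator_one ((hT measurableSet_Ioc).inter hDm),
    integral_indicator_one ((hT measurableSet_Ioi).inter hDm), hind _ measurableSet_Ioc,
    hind _ measurableSet_Ioi, M.measureReal_T_Ioc hζ i hτ hs0 htζ]
  ring

end CoxModel

namespace CoxModel

section model

variable {Ω : Type*} [MeasurableSpace Ω] {P : Measure Ω} {d : ℕ} (M : CoxModel P d)

/-! ### The law of large numbers for the centred jumps -/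

/-- The weighted sum `∑_t w(t) (dN_i(t) - p_i(t) Y_i(t))` of the centred jumps of a subject. -/
noncomputable def centredSum (τ : ℝ) (w : ℝ → ℝ) (i : ℕ) (ω : Ω) : ℝ :=
  ∑ t ∈ M.grid τ, w t * (M.dN τ i t ω - M.cellProb τ i t * M.Y τ i t ω)

end model

section measurability

variable {Ω : Type*} {m : MeasurableSpace Ω} [MeasurableSpace Ω] {P : Measure Ω} {d : ℕ}
  (M : CoxModel P d) {i : ℕ}

theorem measurable_dN (hT : Measurable[m] (M.T i)) (hC : Measurable[m] (M.C i)) (τ t : ℝ) :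
    Measurable[m] (M.dN τ i t) := by
  classical
  have h1 : Measurable fun p : ℝ × ℝ => τ * (⌈p.1 / τ⌉ : ℝ) := by fun_prop
  have h2 : Measurable fun p : ℝ × ℝ => τ * (⌈p.2 / τ⌉ : ℝ) := by fun_prop
  have hF : Measurable fun p : ℝ × ℝ =>
      if min (τ * (⌈p.1 / τ⌉ : ℝ)) (τ * (⌈p.2 / τ⌉ : ℝ)) = t ∧
        τ * (⌈p.1 / τ⌉ : ℝ) ≤ τ * (⌈p.2 / τ⌉ : ℝ) then (1 : ℝ) else 0 :=
    Measurable.ite ((measurableSet_eq_fun (h1.min h2) measurable_const).inter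
      (measurableSet_le h1 h2)) measurable_const measurable_const
  convert hF.comp (hT.prodMk hC) using 1
  funext ω
  simp only [dN, TObs, IsEvent, TStar, CStar, Function.comp_apply]
  congr

theorem measurable_N (hT : Measurable[m] (M.T i)) (hC : Measurable[m] (M.C i)) (τ t : ℝ) :
    Measurable[m] (M.N τ i t) := by
  classical
  have h1 : Measurable fun p : ℝ × ℝ => τ * (⌈p.1 / τ⌉ : ℝ) := by fun_prop
  have h2 : Measurable fun p : ℝ × ℝ => τ * (⌈p.2 / τ⌉ : ℝ) := by fun_prop
  have hF : Measurable fun p : ℝ × ℝ =>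
      if min (τ * (⌈p.1 / τ⌉ : ℝ)) (τ * (⌈p.2 / τ⌉ : ℝ)) ≤ t ∧
        τ * (⌈p.1 / τ⌉ : ℝ) ≤ τ * (⌈p.2 / τ⌉ : ℝ) then (1 : ℝ) else 0 :=
    Measurable.ite ((measurableSet_le (h1.min h2) measurable_const).inter
      (measurableSet_le h1 h2)) measurable_const measurable_const
  convert hF.comp (hT.prodMk hC) using 1
  funext ω
  simp only [N, TObs, IsEvent, TStar, CStar, Function.comp_apply]
  congr

theorem measurable_Y (hT : Measurable[m] (M.T i)) (hC : Measurable[m] (M.C i)) (τ t : ℝ) :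
    Measurable[m] (M.Y τ i t) := by
  classical
  have h1 : Measurable fun p : ℝ × ℝ => τ * (⌈p.1 / τ⌉ : ℝ) := by fun_prop
  have h2 : Measurable fun p : ℝ × ℝ => τ * (⌈p.2 / τ⌉ : ℝ) := by fun_prop
  have hF : Measurable fun p : ℝ × ℝ =>
      if t ≤ min (τ * (⌈p.1 / τ⌉ : ℝ)) (τ * (⌈p.2 / τ⌉ : ℝ)) then (1 : ℝ) else 0 :=
    Measurable.ite (measurableSet_le measurable_const (h1.min h2)) measurable_const
      measurable_const
  convert hF.comp (hT.prodMk hC) using 1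
  funext ω
  simp only [Y, TObs, TStar, CStar, Function.comp_apply]
  congr

theorem measurable_centredSum (hT : Measurable[m] (M.T i)) (hC : Measurable[m] (M.C i)) (τ : ℝ)
    (w : ℝ → ℝ) : Measurable[m] (M.centredSum τ w i) := by
  unfold centredSum
  exact Finset.measurable_sum _ fun t _ => ((M.measurable_dN hT hC τ t).sub
    ((M.measurable_Y hT hC τ t).const_mul _)).const_mul _

end measurability

section model

variable {Ω : Type*} [MeasurableSpace Ω] {P : Measure Ω} {d : ℕ} (M : CoxModel P d)

theorem integrable_dN [IsFiniteMeasure P] (τ : ℝ) (i : ℕ) (t : ℝ) :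
    Integrable (M.dN τ i t) P := by
  refine Integrable.of_bound
    (M.measurable_dN (M.measurable_T i) (M.measurable_C i) τ t).aestronglyMeasurable 1
    (ae_of_all _ fun ω => ?_)
  rw [Real.norm_of_nonneg (M.dN_nonneg τ i t ω)]
  exact M.dN_le_one τ i t ω

theorem integrable_Y [IsFiniteMeasure P] (τ : ℝ) (i : ℕ) (t : ℝ) :
    Integrable (M.Y τ i t) P := by
  refine Integrable.of_bound
    (M.measurable_Y (M.measurable_T i) (M.measurable_C i) τ t).aestronglyMeasurable 1
    (ae_of_all _ fun ω => ?_)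
  rw [Real.norm_of_nonneg (M.Y_nonneg τ i t ω)]
  exact M.Y_le_one τ i t ω

theorem integral_centredSum [IsProbabilityMeasure P] (hζ : M.Lam0 M.ζ < ⊤) {τ : ℝ} (hτ : 0 < τ)
    {m : ℕ} (hm : M.ζ = m * τ) (w : ℝ → ℝ) (i : ℕ) :
    ∫ ω, M.centredSum τ w i ω ∂P = 0 := by
  unfold centredSum
  rw [integral_finsetSum]
  · refine Finset.sum_eq_zero fun t ht => ?_
    rw [integral_const_mul]
    have := M.setIntegral_dN_sub hζ i hτ hm ht (A := Set.univ) MeasurableSet.univ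
    rw [Measure.restrict_univ] at this
    rw [this, mul_zero]
  · exact fun t _ => ((M.integrable_dN τ i t).sub ((M.integrable_Y τ i t).const_mul _)).const_mul _

theorem abs_centredSum_le (hζ : M.Lam0 M.ζ < ⊤) {τ : ℝ} (hτ : 0 < τ)
    {m : ℕ} (hm : M.ζ = m * τ) {w : ℝ → ℝ} {G E : ℝ} (hw : ∀ t ∈ Set.Icc 0 M.ζ, |w t| ≤ G)
    {i : ℕ} (hE : Real.exp (M.x i ⬝ᵥ M.β) ≤ E) (ω : Ω) :
    |M.centredSum τ w i ω| ≤ G * (1 + E * (M.Lam0 M.ζ).toReal) := by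
  have hG : 0 ≤ G := (abs_nonneg _).trans (hw 0 ⟨le_rfl, M.ζ_pos.le⟩)
  calc |M.centredSum τ w i ω|
      ≤ ∑ t ∈ M.grid τ, |w t * (M.dN τ i t ω - M.cellProb τ i t * M.Y τ i t ω)| :=
        Finset.abs_sum_le_sum_abs _ _
    _ ≤ ∑ t ∈ M.grid τ, G * (M.dN τ i t ω + E * M.dLam0Star τ t) := by
        refine Finset.sum_le_sum fun t ht => ?_
        have h0 := M.mem_Ioc_of_mem_grid hτ hm ht
        have h1 := M.dN_nonneg τ i t ω
        have h2 := M.cellProb_nonneg hζ hτ h0.2 i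
        have h3 := M.cellProb_le τ i t
        have h4 := M.Y_nonneg τ i t ω
        have h5 := M.Y_le_one τ i t ω
        have h6 : Real.exp (M.x i ⬝ᵥ M.β) * M.dLam0Star τ t ≤ E * M.dLam0Star τ t :=
          mul_le_mul_of_nonneg_right hE (M.dLam0Star_nonneg hζ hτ h0.2)
        have h7 := mul_nonneg h2 h4
        have h8 := mul_le_of_le_one_right h2 h5
        rw [abs_mul]
        refine mul_le_mul (hw t ⟨h0.1.le, h0.2⟩) ?_ (abs_nonneg _) hG
        rw [abs_le]
        constructor <;> linarith
    _ = G * (∑ t ∈ M.grid τ, M.dN τ i t ω + E * (M.Lam0 M.ζ).toReal) := by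
        rw [← Finset.mul_sum, Finset.sum_add_distrib, ← Finset.mul_sum, M.sum_dLam0Star hτ hm]
    _ ≤ G * (1 + E * (M.Lam0 M.ζ).toReal) := by
        gcongr
        exact M.sum_dN_le_one τ i ω _

theorem tendsto_centredSum [IsProbabilityMeasure P] (hζ : M.Lam0 M.ζ < ⊤) {τ : ℕ → ℝ}
    (hτ : M.IsGrouping τ) {E G : ℝ} (hE : ∀ i, Real.exp (M.x i ⬝ᵥ M.β) ≤ E)
    {w : ℕ → ℝ → ℝ} (hw : ∀ i, ∀ t ∈ Set.Icc 0 M.ζ, |w i t| ≤ G) :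
    Tendsto (fun z : ℕ × Ω => (z.1 : ℝ)⁻¹ *
      ∑ i ∈ Finset.range z.1, M.centredSum (τ z.1) (w i) i z.2) (probFilter P) (𝓝 0) := by
  set D := G * (1 + E * (M.Lam0 M.ζ).toReal)
  have hbd : ∀ n i ω, |M.centredSum (τ n) (w i) i ω| ≤ D := by
    intro n i ω
    obtain ⟨h0, m, hm⟩ := hτ n
    exact M.abs_centredSum_le hζ h0 hm (hw i) (hE i) ω
  have hmeas : ∀ n i, Measurable (M.centredSum (τ n) (w i) i) := fun n i =>
    M.measurable_centredSum (M.measurable_T i) (M.measurable_C i) _ _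
  have hL2 : ∀ n i, MemLp (M.centredSum (τ n) (w i) i) 2 P := fun n i =>
    MemLp.of_bound (hmeas n i).aestronglyMeasurable D (ae_of_all _ fun ω => hbd n i ω)
  have hmean : ∀ n i, ∫ ω, M.centredSum (τ n) (w i) i ω ∂P = 0 := by
    intro n i
    obtain ⟨h0, m, hm⟩ := hτ n
    exact M.integral_centredSum hζ h0 hm (w i) i
  refine tendsto_probFilter_of_variance (P := P)
    (X := fun n ω => (n : ℝ)⁻¹ * ∑ i ∈ Finset.range n, M.centredSum (τ n) (w i) i ω)
    (v := fun n => (n : ℝ)⁻¹ * D ^ 2) ?_ ?_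
  · filter_upwards [eventually_ge_atTop 1] with n hn
    have hn0 : (n : ℝ) ≠ 0 := by positivity
    refine ⟨(memLp_finsetSum _ fun i _ => hL2 n i).const_mul _, ?_, ?_⟩
    · rw [integral_const_mul, integral_finsetSum _ fun i _ => (hL2 n i).integrable (by norm_num)]
      simp [hmean]
    · rw [variance_const_mul]
      have hsum : (fun ω => ∑ i ∈ Finset.range n, M.centredSum (τ n) (w i) i ω) =
          ∑ i ∈ Finset.range n, M.centredSum (τ n) (w i) i := by
        funext ω; simp
      rw [hsum, IndepFun.variance_sum (fun i _ => hL2 n i)]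
      · calc (n : ℝ)⁻¹ ^ 2 * ∑ i ∈ Finset.range n, Var[M.centredSum (τ n) (w i) i; P]
            ≤ (n : ℝ)⁻¹ ^ 2 * ∑ i ∈ Finset.range n, D ^ 2 := by
              gcongr with i
              refine (variance_le_expectation_sq (hmeas n i).aestronglyMeasurable).trans ?_
              calc _ ≤ ∫ ω, D ^ 2 ∂P := by
                    refine integral_mono_of_nonneg (ae_of_all _ fun ω => sq_nonneg _)
                      (integrable_const _) (ae_of_all _ fun ω => ?_)
                    exact sq_le_sq' (abs_le.1 (hbd n i ω)).1 (abs_le.1 (hbd n i ω)).2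
                _ = D ^ 2 := by simp
          _ = (n : ℝ)⁻¹ * D ^ 2 := by
              simp only [Finset.sum_const, Finset.card_range, nsmul_eq_mul]
              field_simp
      · intro i _ j _ hij
        exact indep_of_indep_of_le_left (indep_of_indep_of_le_right (M.indep_subjectInfo hij)
          (M.measurable_centredSum (M.measurable_T_subjectInfo j)
            (M.measurable_C_subjectInfo j) _ _).comap_le)
          (M.measurable_centredSum (M.measurable_T_subjectInfo i)
            (M.measurable_C_subjectInfo i) _ _).comap_le
  · simpa using (tendsto_inv_atTop_nhds_zero_nat (𝕜 := ℝ)).mul_const (D ^ 2)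

/-- The law of large numbers for the jumps `dN_i(t)` with the compensators
`Y_i(t) exp(x_iᵀβ) dΛ₀*(t)`. These differ from the exact ones by terms of second order in the
grouped hazard, which vanish in the limit. -/
theorem tendsto_compensated [IsProbabilityMeasure P] (hζ : M.Lam0 M.ζ < ⊤) {τ : ℕ → ℝ}
    (hτ : M.IsGrouping τ) (hτ0 : Tendsto τ atTop (𝓝 0)) {E G H : ℝ}
    (hE : ∀ i, Real.exp (M.x i ⬝ᵥ M.β) ≤ E)
    (hH : ∀ᶠ n in atTop, ∀ t ∈ M.grid (τ n), M.dLam0Star (τ n) t ≤ H * τ n)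
    {w : ℕ → ℝ → ℝ} (hw : ∀ i, ∀ t ∈ Set.Icc 0 M.ζ, |w i t| ≤ G) :
    Tendsto (fun z : ℕ × Ω => (z.1 : ℝ)⁻¹ * ∑ i ∈ Finset.range z.1, ∑ t ∈ M.grid (τ z.1),
      w i t * (M.dN (τ z.1) i t z.2 -
        M.Y (τ z.1) i t z.2 * Real.exp (M.x i ⬝ᵥ M.β) * M.dLam0Star (τ z.1) t))
      (probFilter P) (𝓝 0) := by
  have hG : 0 ≤ G := (abs_nonneg _).trans (hw 0 0 ⟨le_rfl, M.ζ_pos.le⟩)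
  set L := (M.Lam0 M.ζ).toReal
  have hbound : Tendsto (fun z : ℕ × Ω => G * (E ^ 2 * (H * τ z.1) * L)) (probFilter P) (𝓝 0) := by
    have h : Tendsto (fun n => G * (E ^ 2 * (H * τ n) * L)) atTop
        (𝓝 (G * (E ^ 2 * (H * 0) * L))) :=
      ((((hτ0.const_mul H).const_mul _).mul_const L).const_mul G)
    simpa [Function.comp_def] using h.comp (tendsto_fst_probFilter (P := P))
  have h1 := M.tendsto_centredSum hζ hτ hE hw
  suffices h2 : Tendsto (fun z : ℕ × Ω => (z.1 : ℝ)⁻¹ * ∑ i ∈ Finset.range z.1,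
      ∑ t ∈ M.grid (τ z.1), w i t * (M.Y (τ z.1) i t z.2 * (M.cellProb (τ z.1) i t -
        Real.exp (M.x i ⬝ᵥ M.β) * M.dLam0Star (τ z.1) t))) (probFilter P) (𝓝 0) by
    have h3 := h1.add h2
    rw [add_zero] at h3
    refine h3.congr fun z => ?_
    rw [← mul_add, ← Finset.sum_add_distrib]
    congr 1
    refine Finset.sum_congr rfl fun i _ => ?_
    unfold centredSum
    rw [← Finset.sum_add_distrib]
    exact Finset.sum_congr rfl fun t _ => by ring
  refine squeeze_zero_norm' ?_ hbound
  filter_upwards [tendsto_fst_probFilter.eventually hH,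
    tendsto_fst_probFilter.eventually (eventually_ge_atTop 1)] with ⟨n, ω⟩ hHn hn
  simp only at hHn hn ⊢
  obtain ⟨h0, m, hm⟩ := hτ n
  have hn0 : (n : ℝ) ≠ 0 := by positivity
  have hi : ∀ i, |∑ t ∈ M.grid (τ n), w i t * (M.Y (τ n) i t ω * (M.cellProb (τ n) i t -
      Real.exp (M.x i ⬝ᵥ M.β) * M.dLam0Star (τ n) t))| ≤ G * (E ^ 2 * (H * τ n) * L) := by
    intro i
    calc _ ≤ ∑ t ∈ M.grid (τ n), |w i t * (M.Y (τ n) i t ω * (M.cellProb (τ n) i t -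
          Real.exp (M.x i ⬝ᵥ M.β) * M.dLam0Star (τ n) t))| := Finset.abs_sum_le_sum_abs _ _
      _ ≤ ∑ t ∈ M.grid (τ n), G * (E ^ 2 * (H * τ n) * M.dLam0Star (τ n) t) := by
          refine Finset.sum_le_sum fun t ht => ?_
          have ht' := M.mem_Ioc_of_mem_grid h0 hm ht
          have hΛ := M.dLam0Star_nonneg hζ h0 ht'.2
          rw [abs_mul]
          refine mul_le_mul (hw i t ⟨ht'.1.le, ht'.2⟩) ?_ (abs_nonneg _) hG
          rw [abs_mul, abs_of_nonneg (M.Y_nonneg _ _ _ _)]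
          refine (mul_le_of_le_one_left (abs_nonneg _) (M.Y_le_one _ _ _ _)).trans ?_
          rw [abs_sub_comm, abs_of_nonneg (sub_nonneg.2 (M.cellProb_le _ _ _))]
          calc _ ≤ (Real.exp (M.x i ⬝ᵥ M.β) * M.dLam0Star (τ n) t) ^ 2 := by
                linarith [M.le_cellProb hζ h0 ht'.2 i]
            _ = Real.exp (M.x i ⬝ᵥ M.β) ^ 2 * (M.dLam0Star (τ n) t * M.dLam0Star (τ n) t) := by
                ring
            _ ≤ E ^ 2 * (H * τ n * M.dLam0Star (τ n) t) := by
                have := hE i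
                have := hHn t ht
                gcongr
            _ = _ := by ring
      _ = _ := by rw [← Finset.mul_sum, ← Finset.mul_sum, M.sum_dLam0Star h0 hm]
  rw [norm_mul, norm_inv, RCLike.norm_natCast, Real.norm_eq_abs]
  calc _ ≤ (n : ℝ)⁻¹ * ∑ i ∈ Finset.range n, G * (E ^ 2 * (H * τ n) * L) := by
        gcongr
        exact (Finset.abs_sum_le_sum_abs _ _).trans (Finset.sum_le_sum fun i _ => hi i)
    _ = _ := by
        simp only [Finset.sum_const, Finset.card_range, nsmul_eq_mul]
        field_simp

/-! ### The number of ties -/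

/-- On the event that subject `i` is still event-free at the start of a cell, the history before
the end of the cell involves only the other variables. -/
theorem exists_otherInfo_inter {τ : ℝ} (hτ : 0 < τ) (n i k : ℕ) {A : Set Ω}
    (hA : MeasurableSet[M.histBefore τ n (((k : ℝ) + 1) * τ)] A) :
    ∃ A', MeasurableSet[M.otherInfo i] A' ∧
      ∀ ω, k * τ < M.T i ω → (ω ∈ A ↔ ω ∈ A') := by
  set U := {ω | k * τ < M.T i ω}
  have hle : MeasurableSpace.comap (Subtype.val : U → Ω) (M.histBefore τ n (((k : ℝ) + 1) * τ)) ≤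
      MeasurableSpace.comap (Subtype.val : U → Ω) (M.otherInfo i) := by
    unfold histBefore
    conv_lhs => simp only [MeasurableSpace.comap_iSup, MeasurableSpace.comap_sup,
      MeasurableSpace.comap_comp]
    refine iSup₂_le fun j _ => iSup₂_le fun u hu => ?_
    have hval : Measurable[MeasurableSpace.comap (Subtype.val : U → Ω) (M.otherInfo i),
      M.otherInfo i] (Subtype.val : U → Ω) := comap_measurable _
    by_cases hj : j = i
    · subst hj
      have hT : ∀ ω : U, u < M.TStar τ j ω.1 := fun ω =>
        hu.2.trans_le ((succ_mul_le_mul_ceil hτ k _).2 ω.2)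
      have hN : M.N τ j u ∘ (Subtype.val : U → Ω) = fun _ => 0 := by
        funext ω
        have := hT ω
        unfold N TObs IsEvent
        rw [Function.comp_apply, if_neg]
        rintro ⟨h1, h2⟩
        rw [min_eq_left h2] at h1
        linarith
      have hY : M.Y τ j u ∘ (Subtype.val : U → Ω) =
          (fun ω => (Set.Ici u).indicator (1 : ℝ → ℝ) (M.CStar τ j ω)) ∘ Subtype.val := by
        funext ω
        have := (hT ω).le
        unfold Y TObs
        by_cases h : u ≤ M.CStar τ j ω.1 <;> simp [h, this]
      rw [hN, hY]
      refine sup_le (measurable_const.comap_le) (Measurable.comap_le ?_)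
      refine Measurable.comp (g := fun ω => (Set.Ici u).indicator (1 : ℝ → ℝ) (M.CStar τ j ω))
        ?_ hval
      have h1 : Measurable fun c : ℝ => (Set.Ici u).indicator (1 : ℝ → ℝ) (τ * (⌈c / τ⌉ : ℝ)) :=
        (measurable_one.indicator measurableSet_Ici).comp (by fun_prop)
      exact h1.comp (M.measurable_C_otherInfo j j)
    · exact sup_le
        ((M.measurable_N (M.measurable_T_otherInfo hj) (M.measurable_C_otherInfo i j) τ u).comp
          hval).comap_le
        ((M.measurable_Y (M.measurable_T_otherInfo hj) (M.measurable_C_otherInfo i j) τ u).comp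
          hval).comap_le
  obtain ⟨A', hA', h⟩ := hle _ ⟨A, hA, rfl⟩
  exact ⟨A', hA', fun ω hω => (Set.ext_iff.1 h ⟨ω, hω⟩).symm⟩

theorem histBefore_le (τ : ℝ) (n : ℕ) (t : ℝ) : M.histBefore τ n t ≤ ‹MeasurableSpace Ω› :=
  iSup₂_le fun i _ => iSup₂_le fun u _ => sup_le
    (M.measurable_N (M.measurable_T i) (M.measurable_C i) τ u).comap_le
    (M.measurable_Y (M.measurable_T i) (M.measurable_C i) τ u).comap_le

/-- The jumps `dN_i(t)` have the compensators `p_i(t) Y_i(t)` for the observed history. -/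
theorem condExp_dN_sub [IsProbabilityMeasure P] (hζ : M.Lam0 M.ζ < ⊤) {τ : ℝ}
    (hτ : 0 < τ) {m : ℕ} (hm : M.ζ = m * τ) {t : ℝ} (ht : t ∈ M.grid τ) (n i : ℕ) :
    P[M.dN τ i t - M.cellProb τ i t • M.Y τ i t | M.histBefore τ n t] =ᵐ[P] 0 := by
  have hint : Integrable (M.dN τ i t - M.cellProb τ i t • M.Y τ i t) P :=
    (M.integrable_dN τ i t).sub ((M.integrable_Y τ i t).smul _)
  refine (ae_eq_condExp_of_forall_setIntegral_eq (M.histBefore_le τ n t) hint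
    (fun _ _ _ => integrableOn_zero) (fun A hA _ => ?_) aestronglyMeasurable_zero).symm
  simp only [integral_zero]
  obtain ⟨k, hk, rfl⟩ := (M.mem_grid hτ hm).1 ht
  obtain ⟨A', hA', h⟩ := M.exists_otherInfo_inter hτ n i k hA
  rw [← M.setIntegral_dN_sub hζ i hτ hm ht hA',
    ← integral_indicator (M.otherInfo_le i _ hA'),
    ← integral_indicator (M.histBefore_le τ n _ _ hA)]
  refine integral_congr_ae (ae_of_all _ fun ω => ?_)
  by_cases hω : k * τ < M.T i ω
  · by_cases hωA : ω ∈ A'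
    · simp [hωA, (h ω hω).2 hωA]
    · simp [hωA, mt (h ω hω).1 hωA]
  · have h1 : M.Y τ i (((k : ℝ) + 1) * τ) ω = 0 := by simp [M.Y_eq hτ, hω]
    have h2 : M.dN τ i (((k : ℝ) + 1) * τ) ω = 0 := by rw [← M.dN_mul_Y, h1, mul_zero]
    simp [Set.indicator, h1, h2]

theorem condExp_dNsum_mem [IsProbabilityMeasure P] (hζ : M.Lam0 M.ζ < ⊤) {τ : ℝ}
    (hτ : 0 < τ) {m : ℕ} (hm : M.ζ = m * τ) {t : ℝ} (ht : t ∈ M.grid τ) (n : ℕ) {E : ℝ}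
    (hE : ∀ i, Real.exp (M.x i ⬝ᵥ M.β) ≤ E) :
    ∀ᵐ ω ∂P, (P[M.dNsum τ n t | M.histBefore τ n t]) ω ∈
      Set.Icc 0 (n * (E * M.dLam0Star τ t)) := by
  have ht' := M.mem_Ioc_of_mem_grid hτ hm ht
  have hsum : M.dNsum τ n t = ∑ i ∈ Finset.range n, M.dN τ i t := by
    funext ω; simp [dNsum]
  have h1 := condExp_finsetSum (s := Finset.range n) (fun i _ => M.integrable_dN τ i t)
    (M.histBefore τ n t)
  have h2 : ∀ᵐ ω ∂P, ∀ i, (P[M.dN τ i t | M.histBefore τ n t]) ω ∈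
      Set.Icc 0 (E * M.dLam0Star τ t) := by
    rw [ae_all_iff]
    intro i
    have hp := M.cellProb_nonneg hζ hτ ht'.2 i
    have a1 := condExp_nonneg (μ := P) (m := M.histBefore τ n t)
      (ae_of_all P fun ω => M.dN_nonneg τ i t ω)
    have a2 := M.condExp_dN_sub hζ hτ hm ht n i
    have a3 := condExp_sub (M.integrable_dN τ i t)
      ((M.integrable_Y τ i t).smul (M.cellProb τ i t)) (M.histBefore τ n t)
    have a4 : P[M.cellProb τ i t • M.Y τ i t | M.histBefore τ n t] ≤ᵐ[P]
        P[fun _ => M.cellProb τ i t | M.histBefore τ n t] := by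
      refine condExp_mono ((M.integrable_Y τ i t).smul _) (integrable_const _)
        (ae_of_all _ fun ω => ?_)
      exact mul_le_of_le_one_right hp (M.Y_le_one τ i t ω)
    rw [condExp_const (M.histBefore_le τ n t)] at a4
    filter_upwards [a1, a2, a3, a4] with ω b1 b2 b3 b4
    refine ⟨b1, ?_⟩
    rw [b2] at b3
    simp only [Pi.zero_apply, Pi.sub_apply] at b3
    calc _ ≤ M.cellProb τ i t := by linarith
      _ ≤ _ := M.cellProb_le τ i t
      _ ≤ _ := mul_le_mul_of_nonneg_right (hE i) (M.dLam0Star_nonneg hζ hτ ht'.2)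
  filter_upwards [h1, h2] with ω b1 b2
  rw [hsum, b1, Finset.sum_apply]
  refine ⟨Finset.sum_nonneg fun i _ => (b2 i).1, ?_⟩
  calc _ ≤ ∑ i ∈ Finset.range n, E * M.dLam0Star τ t := Finset.sum_le_sum fun i _ => (b2 i).2
    _ = _ := by simp

theorem isBigOP_numEvents [IsProbabilityMeasure P] (hζ : M.Lam0 M.ζ < ⊤) {τ : ℕ → ℝ}
    (hτ : M.IsGrouping τ) {E H : ℝ} (hE : ∀ i, Real.exp (M.x i ⬝ᵥ M.β) ≤ E) (hH0 : 0 < H)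
    (hH : ∀ᶠ n in atTop, ∀ t ∈ M.grid (τ n), M.dLam0Star (τ n) t ≤ H * τ n)
    (h5 : M.TieOrder τ) :
    IsBigOP P (fun n ω => ⨆ t : M.grid (τ n), (M.numEvents (τ n) n t ω : ℝ))
      (fun n _ => (n : ℝ) * τ n) := by
  obtain ⟨K, hK, h⟩ := h5
  have hE0 : 0 < E := (Real.exp_pos _).trans_le (hE 0)
  refine ⟨K * (E * H), by positivity, ?_⟩
  refine tendsto_of_tendsto_of_tendsto_of_le_of_le' tendsto_const_nhds h
    (Eventually.of_forall fun _ => zero_le) ?_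
  filter_upwards [hH] with n hHn
  obtain ⟨h0, m, hm⟩ := hτ n
  refine measure_mono_ae ?_
  have hall : ∀ᵐ ω ∂P, ∀ t : M.grid (τ n),
      (P[M.dNsum (τ n) n t | M.histBefore (τ n) n t]) ω ∈
        Set.Icc 0 (n * (E * M.dLam0Star (τ n) t)) :=
    ae_all_iff.2 fun t => M.condExp_dNsum_mem hζ h0 hm t.2 n hE
  filter_upwards [hall] with ω hω
  intro (hlt : K * (E * H) * |(n : ℝ) * τ n| < |⨆ t : M.grid (τ n), (M.numEvents (τ n) n t ω : ℝ)|)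
  simp only [numEvents_cast] at hlt
  refine lt_of_le_of_lt ?_ hlt
  rw [abs_of_nonneg (by positivity : 0 ≤ (n : ℝ) * τ n), mul_assoc]
  refine mul_le_mul_of_nonneg_left ?_ hK.le
  rw [abs_of_nonneg (Real.iSup_nonneg fun t => (hω t).1)]
  refine Real.iSup_le (fun t => (hω t).2.trans ?_) (by positivity)
  calc (n : ℝ) * (E * M.dLam0Star (τ n) t) ≤ n * (E * (H * τ n)) := by
        gcongr
        exact hHn t t.2
    _ = _ := by ring

end model

end CoxModel

/-! ### Uniform limits -/

/-- Uniform convergence is preserved by a function that is continuous at the points of a compact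
set which contains the values of the limit. -/
theorem TendstoUniformlyOn.comp_of_isCompact {ι X α γ : Type*} [UniformSpace α] [UniformSpace γ]
    {F : ι → X → α} {f : X → α} {l : Filter ι} {s : Set X} (h : TendstoUniformlyOn F f l s)
    {K : Set α} (hK : IsCompact K) (hf : Set.MapsTo f s K) {Φ : α → γ}
    (hΦ : ∀ a ∈ K, ContinuousAt Φ a) :
    TendstoUniformlyOn (fun i x => Φ (F i x)) (fun x => Φ (f x)) l s := by
  intro r hr
  filter_upwards [h _ (hK.uniformContinuousAt_of_continuousAt Φ hΦ hr)] with i hi x hx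
  exact hi x hx (hf hx)

theorem TendstoUniformlyOn.const_index {ι X α : Type*} [UniformSpace α] (f : X → α) (l : Filter ι)
    (s : Set X) : TendstoUniformlyOn (fun _ => f) f l s := fun _ hr =>
  Eventually.of_forall fun _ _ _ => refl_mem_uniformity hr

theorem TendstoUniformlyOn.comp_index {ι κ X α : Type*} [UniformSpace α] {F : ι → X → α}
    {f : X → α} {l : Filter ι} {s : Set X} (h : TendstoUniformlyOn F f l s) {u : κ → ι}
    {l' : Filter κ} (hu : Tendsto u l' l) : TendstoUniformlyOn (fun j => F (u j)) f l' s :=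
  fun r hr => hu.eventually (h r hr)

theorem TendstoUniformlyOn.pair {ι X α γ : Type*} [UniformSpace α] [UniformSpace γ]
    {F : ι → X → α} {f : X → α} {F' : ι → X → γ} {f' : X → γ} {l : Filter ι} {s : Set X}
    (h : TendstoUniformlyOn F f l s) (h' : TendstoUniformlyOn F' f' l s) :
    TendstoUniformlyOn (fun i x => (F i x, F' i x)) (fun x => (f x, f' x)) l s :=
  (h.prodMk h').comp_index (tendsto_id.prodMk tendsto_id)

/-- Sums with nonnegative weights of bounded total mass inherit convergence to zero from the
uniform convergence of the summands. -/
theorem tendsto_sum_mul_sub {ι : Type*} {l : Filter ι} {c : ι → ℝ → ℝ} {c0 : ℝ → ℝ} {s : Set ℝ}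
    (h : TendstoUniformlyOn c c0 l s) {S : ι → Finset ℝ} {W : ι → ℝ → ℝ} {D : ℝ}
    (hS : ∀ i, ∀ t ∈ S i, t ∈ s ∧ 0 ≤ W i t) (hW : ∀ i, ∑ t ∈ S i, W i t ≤ D) :
    Tendsto (fun i => ∑ t ∈ S i, W i t * (c i t - c0 t)) l (𝓝 0) := by
  rw [Metric.tendsto_nhds]
  intro ε hε
  rw [Metric.tendstoUniformlyOn_iff] at h
  filter_upwards [h (ε / (|D| + 1)) (by positivity)] with i hi
  rw [Real.dist_eq, sub_zero]
  calc |∑ t ∈ S i, W i t * (c i t - c0 t)| ≤ ∑ t ∈ S i, W i t * (ε / (|D| + 1)) := by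
        refine (Finset.abs_sum_le_sum_abs _ _).trans (Finset.sum_le_sum fun t ht => ?_)
        rw [abs_mul, abs_of_nonneg (hS i t ht).2, abs_sub_comm]
        exact mul_le_mul_of_nonneg_left (hi t (hS i t ht).1).le (hS i t ht).2
    _ ≤ D * (ε / (|D| + 1)) := by
        rw [← Finset.sum_mul]
        exact mul_le_mul_of_nonneg_right (hW i) (by positivity)
    _ ≤ |D| * (ε / (|D| + 1)) := by gcongr; exact le_abs_self D
    _ < (|D| + 1) * (ε / (|D| + 1)) := by gcongr; linarith
    _ = ε := by field_simp

namespace CoxModel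

variable {Ω : Type*} [MeasurableSpace Ω] {P : Measure Ω} {d : ℕ} (M : CoxModel P d)

theorem tendstoUniformlyOn_of_uniformLimit {E : Type*} [NormedAddCommGroup E] [Module ℝ E]
    {B : Set (Fin d → ℝ)} (hB : IsOpen B) {b₀ : Fin d → ℝ} (hb₀ : b₀ ∈ B)
    {S : ℕ → Ω → (Fin d → ℝ) → ℝ → E} {s : (Fin d → ℝ) → ℝ → E} (h : M.UniformLimitInProb B S s)
    (hs : EquicontinuousOn (fun (t : Set.Icc 0 M.ζ) b => s b t) B) :
    TendstoUniformlyOn (fun (y : (ℕ × Ω) × (Fin d → ℝ)) t =>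
      (y.1.1 : ℝ)⁻¹ • S y.1.1 y.1.2 y.2 t) (s b₀) (probFilter P ×ˢ 𝓝 b₀) (Set.Icc 0 M.ζ) := by
  rw [Metric.tendstoUniformlyOn_iff]
  intro ε hε
  have h1 : ∀ᶠ z in probFilter P, ∀ b ∈ B, ∀ t ∈ Set.Icc 0 M.ζ,
      ‖(z.1 : ℝ)⁻¹ • S z.1 z.2 b t - s b t‖ ≤ ε / 3 := by
    rw [eventually_probFilter_iff]
    convert h (ε / 3) (by positivity) using 4 with n
    ext ω
    push Not
    rfl
  have h2 : ∀ᶠ b in 𝓝 b₀, ∀ t ∈ Set.Icc 0 M.ζ, dist (s b₀ t) (s b t) < ε / 3 := by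
    have := hs b₀ hb₀ _ (Metric.dist_mem_uniformity (by positivity : 0 < ε / 3))
    rw [hB.nhdsWithin_eq hb₀] at this
    filter_upwards [this] with b hb t ht
    exact hb ⟨t, ht⟩
  filter_upwards [h1.prod_mk (h2.and (hB.mem_nhds hb₀))] with y hy t ht
  have a1 := hy.1 y.2 hy.2.2 t ht
  have a2 := hy.2.1 t ht
  rw [← dist_eq_norm, dist_comm] at a1
  linarith [dist_triangle (s b₀ t) (s y.2 t) ((y.1.1 : ℝ)⁻¹ • S y.1.1 y.1.2 y.2 t)]

section limits

variable {τ : ℕ → ℝ} {B : Set (Fin d → ℝ)} {s0 : (Fin d → ℝ) → ℝ → ℝ}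
  {s1 : (Fin d → ℝ) → ℝ → Fin d → ℝ} {s2 : (Fin d → ℝ) → ℝ → Matrix (Fin d) (Fin d) ℝ}

theorem uniform_S0 (h7 : M.RegularLimits τ B s0 s1 s2) :
    TendstoUniformlyOn (fun (y : (ℕ × Ω) × (Fin d → ℝ)) t =>
      (y.1.1 : ℝ)⁻¹ * M.S0 (τ y.1.1) y.1.1 y.1.2 y.2 t) (s0 M.β) (probFilter P ×ˢ 𝓝 M.β)
      (Set.Icc 0 M.ζ) :=
  M.tendstoUniformlyOn_of_uniformLimit h7.isOpen h7.mem h7.limit0 h7.equicont0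

theorem uniform_S1 (h7 : M.RegularLimits τ B s0 s1 s2) (k : Fin d) :
    TendstoUniformlyOn (fun (y : (ℕ × Ω) × (Fin d → ℝ)) t =>
      (y.1.1 : ℝ)⁻¹ * M.S1 (τ y.1.1) y.1.1 y.1.2 y.2 t k) (fun t => s1 M.β t k)
      (probFilter P ×ˢ 𝓝 M.β) (Set.Icc 0 M.ζ) :=
  (Pi.uniformContinuous_proj (fun _ : Fin d => ℝ) k).comp_tendstoUniformlyOn
    (M.tendstoUniformlyOn_of_uniformLimit h7.isOpen h7.mem h7.limit1 h7.equicont1)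

theorem uniform_S2 (h7 : M.RegularLimits τ B s0 s1 s2) (k l : Fin d) :
    TendstoUniformlyOn (fun (y : (ℕ × Ω) × (Fin d → ℝ)) t =>
      (y.1.1 : ℝ)⁻¹ * M.S2 (τ y.1.1) y.1.1 y.1.2 y.2 t k l) (fun t => s2 M.β t k l)
      (probFilter P ×ˢ 𝓝 M.β) (Set.Icc 0 M.ζ) := by
  have h := M.tendstoUniformlyOn_of_uniformLimit h7.isOpen h7.mem h7.limit2 h7.equicont2
  rw [Metric.tendstoUniformlyOn_iff] at h ⊢
  intro ε hε
  filter_upwards [h ε hε] with y hy t ht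
  refine lt_of_le_of_lt ?_ (hy t ht)
  rw [dist_eq_norm, dist_eq_norm]
  exact Matrix.norm_entry_le_entrywise_sup_norm
    (s2 M.β t - (y.1.1 : ℝ)⁻¹ • M.S2 (τ y.1.1) y.1.1 y.1.2 y.2 t)

/-- The range of `(s⁽⁰⁾, s⁽¹⁾_k, s⁽¹⁾_l, s⁽²⁾_kl)(β, ·)` lies in a box on which the first coordinate
is bounded away from zero. -/
theorem exists_box (h7 : M.RegularLimits τ B s0 s1 s2) :
    ∃ m K : ℝ, 0 < m ∧ ∀ t ∈ Set.Icc 0 M.ζ, s0 M.β t ∈ Set.Icc m K ∧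
      (∀ k, s1 M.β t k ∈ Set.Icc (-K) K) ∧ ∀ k l, s2 M.β t k l ∈ Set.Icc (-K) K := by
  obtain ⟨m, hm, hl⟩ := h7.lower
  obtain ⟨K, hK, hu⟩ := h7.upper
  refine ⟨m, K, hm, fun t ht => ?_⟩
  obtain ⟨u0, u1, u2⟩ := hu M.β h7.mem t ht
  refine ⟨⟨(hl _ h7.mem t ht).le, (le_abs_self _).trans u0⟩, fun k => ?_, fun k l => ?_⟩
  · exact abs_le.1 ((norm_le_pi_norm (s1 M.β t) k).trans u1)
  · exact abs_le.1 ((Matrix.norm_entry_le_entrywise_sup_norm (s2 M.β t)).trans u2)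

theorem eventually_S0_pos (h7 : M.RegularLimits τ B s0 s1 s2) :
    ∀ᶠ y : (ℕ × Ω) × (Fin d → ℝ) in probFilter P ×ˢ 𝓝 M.β, 0 < (y.1.1 : ℝ) ∧
      ∀ t ∈ Set.Icc 0 M.ζ, 0 < M.S0 (τ y.1.1) y.1.1 y.1.2 y.2 t := by
  obtain ⟨m, K, hm, hb⟩ := M.exists_box h7
  have h := Metric.tendstoUniformlyOn_iff.1 (M.uniform_S0 h7) m hm
  have hn := (tendsto_fst_probFilter.comp (tendsto_fst (f := probFilter P)
    (g := 𝓝 M.β))).eventually (eventually_gt_atTop 0)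
  filter_upwards [h, hn] with y hy hny
  have hny' : 0 < (y.1.1 : ℝ) := by exact_mod_cast hny
  refine ⟨hny', fun t ht => ?_⟩
  have h1 := hy t ht
  rw [Real.dist_eq] at h1
  have h2 := (hb t ht).1.1
  have h3 : 0 < (y.1.1 : ℝ)⁻¹ * M.S0 (τ y.1.1) y.1.1 y.1.2 y.2 t := by linarith [(abs_lt.1 h1).2]
  exact (pos_iff_pos_of_mul_pos h3).1 (by positivity)

theorem uniform_qMean (h7 : M.RegularLimits τ B s0 s1 s2) (k : Fin d) :
    TendstoUniformlyOn (fun (y : (ℕ × Ω) × (Fin d → ℝ)) t =>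
      M.qMean (τ y.1.1) y.1.1 y.1.2 y.2 t k) (fun t => s1 M.β t k / s0 M.β t)
      (probFilter P ×ˢ 𝓝 M.β) (Set.Icc 0 M.ζ) := by
  obtain ⟨m, K, hm, hb⟩ := M.exists_box h7
  have h := (((M.uniform_S0 h7).pair (M.uniform_S1 h7 k))).comp_of_isCompact
    ((isCompact_Icc (a := m) (b := K)).prod (isCompact_Icc (a := -K) (b := K)))
    (fun t ht => ⟨(hb t ht).1, (hb t ht).2.1 k⟩) (Φ := fun p : ℝ × ℝ => p.2 / p.1)
    (fun a ha => continuousAt_snd.div continuousAt_fst (hm.trans_le ha.1.1).ne')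
  refine h.congr ?_
  filter_upwards [M.eventually_S0_pos h7] with y hy t ht
  have := hy.1
  have := hy.2 t ht
  simp only [qMean_eq]
  field_simp

theorem limitCov_apply (b : Fin d → ℝ) (t : ℝ) (k l : Fin d) :
    limitCov s0 s1 s2 b t k l =
      s2 b t k l / s0 b t - s1 b t k / s0 b t * (s1 b t l / s0 b t) := by
  simp only [limitCov, Matrix.sub_apply, Matrix.smul_apply, Matrix.vecMulVec_apply, Pi.smul_apply,
    smul_eq_mul]
  ring

/-- The box of `exists_box` as a compact set. -/
theorem isCompact_box (m K : ℝ) : IsCompact (Set.Icc m K ×ˢ (Set.Icc (-K) K ×ˢ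
    (Set.Icc (-K) K ×ˢ Set.Icc (-K) K)) : Set (ℝ × ℝ × ℝ × ℝ)) :=
  isCompact_Icc.prod (isCompact_Icc.prod (isCompact_Icc.prod isCompact_Icc))

theorem continuousAt_cov {m K : ℝ} (hm : 0 < m) {a : ℝ × ℝ × ℝ × ℝ}
    (ha : a ∈ Set.Icc m K ×ˢ (Set.Icc (-K) K ×ˢ (Set.Icc (-K) K ×ˢ Set.Icc (-K) K))) :
    ContinuousAt (fun p : ℝ × ℝ × ℝ × ℝ => p.2.2.2 / p.1 - p.2.1 / p.1 * (p.2.2.1 / p.1)) a := by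
  have : a.1 ≠ 0 := (hm.trans_le ha.1.1).ne'
  fun_prop (disch := assumption)

theorem uniform_qCov (h7 : M.RegularLimits τ B s0 s1 s2) (k l : Fin d) :
    TendstoUniformlyOn (fun (y : (ℕ × Ω) × (Fin d → ℝ)) t =>
      M.qCov (τ y.1.1) y.1.1 y.1.2 y.2 t k l) (fun t => limitCov s0 s1 s2 M.β t k l)
      (probFilter P ×ˢ 𝓝 M.β) (Set.Icc 0 M.ζ) := by
  obtain ⟨m, K, hm, hb⟩ := M.exists_box h7
  have h := ((M.uniform_S0 h7).pair ((M.uniform_S1 h7 k).pair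
    ((M.uniform_S1 h7 l).pair (M.uniform_S2 h7 k l)))).comp_of_isCompact
    (isCompact_box m K) (fun t ht => ⟨(hb t ht).1, (hb t ht).2.1 k, (hb t ht).2.1 l,
      (hb t ht).2.2 k l⟩) (fun a ha => continuousAt_cov hm ha)
  refine (h.congr ?_).congr_right ?_
  · filter_upwards [M.eventually_S0_pos h7] with y hy t ht
    have := hy.1
    have := hy.2 t ht
    simp only [M.qCov_eq _ _ _ _ _ _ _ this.ne']
    field_simp
  · exact fun t _ => (limitCov_apply (s0 := s0) (s1 := s1) (s2 := s2) M.β t k l).symm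

theorem exists_abs_limitCov_le (h7 : M.RegularLimits τ B s0 s1 s2) (k l : Fin d) :
    ∃ G, ∀ t ∈ Set.Icc 0 M.ζ, |limitCov s0 s1 s2 M.β t k l| ≤ G := by
  obtain ⟨m, K, hm, hb⟩ := M.exists_box h7
  obtain ⟨G, hG⟩ := (isCompact_box m K).exists_bound_of_continuousOn
    (fun a ha => (continuousAt_cov hm ha).continuousWithinAt)
  refine ⟨G, fun t ht => ?_⟩
  rw [limitCov_apply]
  exact hG (s0 M.β t, s1 M.β t k, s1 M.β t l, s2 M.β t k l)
    ⟨(hb t ht).1, (hb t ht).2.1 k, (hb t ht).2.1 l, (hb t ht).2.2 k l⟩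

/-! ### Riemann sums for the baseline hazard -/

/-- The end `τ ⌈t / τ⌉` of the cell of `t`. -/
noncomputable def cellEnd (τ t : ℝ) : ℝ := τ * (⌈t / τ⌉ : ℝ)

theorem cellEnd_mem {τ : ℝ} (hτ : 0 < τ) {m : ℕ} (hm : M.ζ = m * τ) {t : ℝ}
    (ht : t ∈ Set.Ioc 0 M.ζ) : cellEnd τ t ∈ Set.Icc 0 M.ζ := by
  have h1 : (0 : ℝ) ≤ (⌈t / τ⌉ : ℝ) := by
    exact_mod_cast Int.ceil_nonneg (div_nonneg ht.1.le hτ.le)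
  refine ⟨mul_nonneg hτ.le h1, ?_⟩
  have h2 : ⌈t / τ⌉ ≤ (m : ℤ) := by
    rw [Int.ceil_le, div_le_iff₀ hτ]
    exact_mod_cast hm ▸ ht.2
  have h3 : (⌈t / τ⌉ : ℝ) ≤ m := by exact_mod_cast h2
  rw [hm, mul_comm, cellEnd, mul_comm τ, mul_comm τ]
  gcongr

/-- The risk indicators are constant on the cells. -/
theorem Y_cellEnd {τ : ℝ} (hτ : 0 < τ) (i : ℕ) (t : ℝ) (ω : Ω) :
    M.Y τ i (cellEnd τ t) ω = M.Y τ i t ω := by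
  have key : ∀ z : ℤ, cellEnd τ t ≤ τ * (z : ℝ) ↔ t ≤ τ * (z : ℝ) := by
    intro z
    rw [cellEnd, mul_le_mul_iff_right₀ hτ, Int.cast_le, Int.ceil_le, div_le_iff₀ hτ, mul_comm]
  unfold Y TObs TStar CStar
  simp only [le_min_iff, key]

/-- A uniform limit of functions which are constant on the cells is continuous along the cell
ends. -/
theorem tendsto_cellEnd [IsProbabilityMeasure P] (hτ : M.IsGrouping τ) {F : ℕ × Ω → ℝ → ℝ}
    {f : ℝ → ℝ} (hF : TendstoUniformlyOn F f (probFilter P) (Set.Icc 0 M.ζ))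
    (hcell : ∀ z t, F z (cellEnd (τ z.1) t) = F z t) {t : ℝ} (ht : t ∈ Set.Ioc 0 M.ζ) :
    Tendsto (fun n => f (cellEnd (τ n) t)) atTop (𝓝 (f t)) := by
  rw [Metric.tendsto_nhds]
  intro ε hε
  rw [Metric.tendstoUniformlyOn_iff] at hF
  apply eventually_atTop_of_probFilter (P := P)
  filter_upwards [hF (ε / 2) (by positivity)] with z hz
  obtain ⟨h0, m, hm⟩ := hτ z.1
  have a1 := hz t ⟨ht.1.le, ht.2⟩
  have a2 := hz _ (M.cellEnd_mem h0 hm ht)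
  rw [hcell] at a2
  rw [dist_comm] at a1
  linarith [dist_triangle (f (cellEnd (τ z.1) t)) (F z t) (f t)]

theorem integrable_lam0 (hζ : M.Lam0 M.ζ < ⊤) :
    IntegrableOn (fun t => (M.lam0 t : ℝ)) (Set.Ioc 0 M.ζ) := by
  refine ⟨M.measurable_lam0.coe_nnreal_real.aestronglyMeasurable, ?_⟩
  simpa [HasFiniteIntegral, Lam0] using hζ

theorem dLam0Star_eq_integral (hζ : M.Lam0 M.ζ < ⊤) {τ t : ℝ} (hτ : 0 < τ) (h0 : 0 ≤ t - τ)
    (ht : t ≤ M.ζ) : M.dLam0Star τ t = ∫ s in (t - τ)..t, (M.lam0 s : ℝ) := by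
  have hL : ∀ u, (M.Lam0 u).toReal = ∫ s in Set.Ioc 0 u, (M.lam0 s : ℝ) := by
    intro u
    rw [integral_eq_lintegral_of_nonneg_ae (ae_of_all _ fun s => (M.lam0 s).coe_nonneg)
      M.measurable_lam0.coe_nnreal_real.aestronglyMeasurable]
    simp [Lam0]
  have hI : ∀ u, 0 ≤ u → u ≤ M.ζ →
      IntervalIntegrable (fun s => (M.lam0 s : ℝ)) volume 0 u := by
    intro u hu hu'
    rw [intervalIntegrable_iff_integrableOn_Ioc_of_le hu]
    exact (M.integrable_lam0 hζ).mono_set (Set.Ioc_subset_Ioc_right hu')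
  unfold dLam0Star
  rw [hL, hL, ← intervalIntegral.integral_of_le h0,
    ← intervalIntegral.integral_of_le (by linarith : 0 ≤ t),
    intervalIntegral.integral_interval_sub_left (hI _ (by linarith) ht) (hI _ h0 (by linarith))]

theorem measurable_comp_cellEnd (f : ℝ → ℝ) (τ : ℝ) : Measurable fun t => f (cellEnd τ t) := by
  have h1 : Measurable fun z : ℤ => f (τ * (z : ℝ)) := measurable_from_top
  have h2 : Measurable fun t : ℝ => ⌈t / τ⌉ := by fun_prop
  exact h1.comp h2

theorem sum_dLam0Star_mul (hζ : M.Lam0 M.ζ < ⊤) {τ : ℝ} (hτ : 0 < τ) {m : ℕ} (hm : M.ζ = m * τ)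
    {f : ℝ → ℝ} {D : ℝ} (hf : ∀ t ∈ Set.Icc 0 M.ζ, |f t| ≤ D) :
    ∑ t ∈ M.grid τ, M.dLam0Star τ t * f t =
      ∫ t in Set.Ioc 0 M.ζ, f (cellEnd τ t) * (M.lam0 t : ℝ) := by
  have hint : IntegrableOn (fun t => f (cellEnd τ t) * (M.lam0 t : ℝ)) (Set.Ioc 0 M.ζ) := by
    refine Integrable.bdd_mul (M.integrable_lam0 hζ)
      (measurable_comp_cellEnd f τ).aestronglyMeasurable (c := D) ?_
    filter_upwards [ae_restrict_mem measurableSet_Ioc] with t ht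
    exact hf _ (M.cellEnd_mem hτ hm ht)
  have hsub : ∀ k < m, Set.Ioc ((k : ℝ) * τ) (((k + 1 : ℕ) : ℝ) * τ) ⊆ Set.Ioc 0 M.ζ := by
    intro k hk t ht
    refine ⟨lt_of_le_of_lt (by positivity) ht.1, ht.2.trans ?_⟩
    rw [hm]
    gcongr
    exact_mod_cast hk
  have hle : ∀ k : ℕ, (k : ℝ) * τ ≤ ((k + 1 : ℕ) : ℝ) * τ := by
    intro k; gcongr; simp
  rw [M.sum_grid hτ hm, ← intervalIntegral.integral_of_le M.ζ_pos.le]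
  have hadj := intervalIntegral.sum_integral_adjacent_intervals (a := fun k : ℕ => (k : ℝ) * τ)
    (n := m) (f := fun t => f (cellEnd τ t) * (M.lam0 t : ℝ)) (μ := volume) (fun k hk => by
      rw [intervalIntegrable_iff_integrableOn_Ioc_of_le (hle k)]
      exact hint.mono_set (hsub k hk))
  simp only [Nat.cast_zero, zero_mul] at hadj
  rw [hm, ← hadj]
  refine Finset.sum_congr rfl fun k hk => ?_
  have hk' := Finset.mem_range.1 hk
  have he : ((k : ℝ) + 1) * τ - τ = k * τ := by ring
  rw [M.dLam0Star_eq_integral hζ hτ (by rw [he]; positivity)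
    (M.mem_Ioc_of_mem_grid hτ hm ((M.mem_grid hτ hm).2 ⟨k, hk', rfl⟩)).2, he, mul_comm,
    ← intervalIntegral.integral_const_mul]
  push_cast
  have hle' := hle k
  push_cast at hle'
  rw [intervalIntegral.integral_of_le hle', intervalIntegral.integral_of_le hle']
  refine setIntegral_congr_fun measurableSet_Ioc fun t ht => ?_
  have hc : ⌈t / τ⌉ = (k : ℤ) + 1 := by
    rw [Int.ceil_eq_iff]
    constructor
    · rw [lt_div_iff₀ hτ]; push_cast; linarith [ht.1]
    · rw [div_le_iff₀ hτ]; push_cast; exact ht.2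
  simp only [cellEnd, hc]
  push_cast
  rw [mul_comm τ]

theorem tendsto_sum_dLam0Star_mul (hζ : M.Lam0 M.ζ < ⊤) (hτ : M.IsGrouping τ)
    {f : ℝ → ℝ} {D : ℝ} (hf : ∀ t ∈ Set.Icc 0 M.ζ, |f t| ≤ D)
    (hlim : ∀ t ∈ Set.Ioc 0 M.ζ, Tendsto (fun n => f (cellEnd (τ n) t)) atTop (𝓝 (f t))) :
    Tendsto (fun n => ∑ t ∈ M.grid (τ n), M.dLam0Star (τ n) t * f t) atTop
      (𝓝 (∫ t in Set.Ioc 0 M.ζ, f t * (M.lam0 t : ℝ))) := by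
  have h : ∀ n, ∑ t ∈ M.grid (τ n), M.dLam0Star (τ n) t * f t =
      ∫ t in Set.Ioc 0 M.ζ, f (cellEnd (τ n) t) * (M.lam0 t : ℝ) := by
    intro n
    obtain ⟨h0, m, hm⟩ := hτ n
    exact M.sum_dLam0Star_mul hζ h0 hm hf
  simp only [h]
  refine tendsto_integral_of_dominated_convergence (fun t => D * (M.lam0 t : ℝ)) ?_
    ((M.integrable_lam0 hζ).const_mul D) ?_ ?_
  · exact fun n => ((measurable_comp_cellEnd f (τ n)).mul
      M.measurable_lam0.coe_nnreal_real).aestronglyMeasurable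
  · intro n
    obtain ⟨h0, m, hm⟩ := hτ n
    filter_upwards [ae_restrict_mem measurableSet_Ioc] with t ht
    rw [norm_mul, Real.norm_of_nonneg (M.lam0 t).coe_nonneg]
    exact mul_le_mul_of_nonneg_right (hf _ (M.cellEnd_mem h0 hm ht)) (M.lam0 t).coe_nonneg
  · filter_upwards [ae_restrict_mem measurableSet_Ioc] with t ht
    exact (hlim t ht).mul_const _

end limits

end CoxModel

namespace CoxModel

variable {Ω : Type*} [MeasurableSpace Ω] {P : Measure Ω} {d : ℕ} (M : CoxModel P d)

/-! ### The limits of the score and of the information matrix -/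

section limits

variable {τ : ℕ → ℝ} {B : Set (Fin d → ℝ)} {s0 : (Fin d → ℝ) → ℝ → ℝ}
  {s1 : (Fin d → ℝ) → ℝ → Fin d → ℝ} {s2 : (Fin d → ℝ) → ℝ → Matrix (Fin d) (Fin d) ℝ}

/-- A coordinate of the score `∑_t ∑_i dN_i(t) (x_i - ε(β, t))`, the gradient of the log partial
likelihood at `β`. -/
noncomputable def score (τ : ℝ) (n : ℕ) (ω : Ω) (k : Fin d) : ℝ :=
  ∑ t ∈ M.grid τ, ∑ i ∈ Finset.range n,
    M.dN τ i t ω * (M.x i k - M.qMean τ n ω M.β t k)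

theorem tendsto_atBeta (P : Measure Ω) (b : Fin d → ℝ) :
    Tendsto (fun z : ℕ × Ω => (z, b)) (probFilter P) (probFilter P ×ˢ 𝓝 b) :=
  tendsto_id.prodMk tendsto_const_nhds

theorem tendsto_sum_dNsum_mul_sub (hτ : M.IsGrouping τ) {ι : Type*} {l : Filter ι}
    (u : ι → ℕ × Ω) {c : ι → ℝ → ℝ} {c0 : ℝ → ℝ}
    (h : TendstoUniformlyOn c c0 l (Set.Icc 0 M.ζ)) :
    Tendsto (fun y => ∑ t ∈ M.grid (τ (u y).1),
      ((u y).1 : ℝ)⁻¹ * M.dNsum (τ (u y).1) (u y).1 t (u y).2 * (c y t - c0 t)) l (𝓝 0) := by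
  refine tendsto_sum_mul_sub h (D := 1) (fun y t ht => ?_) (fun y => ?_)
  · obtain ⟨h0, m, hm⟩ := hτ (u y).1
    exact ⟨Set.Ioc_subset_Icc_self (M.mem_Ioc_of_mem_grid h0 hm ht),
      mul_nonneg (by positivity) (M.dNsum_nonneg _ _ _ _)⟩
  · rw [← Finset.mul_sum]
    exact (mul_le_mul_of_nonneg_left (M.sum_dNsum_le _ _ _ _) (by positivity)).trans
      (inv_mul_le_one)

theorem tendsto_sum_dLam0Star_mul_sub (hζ : M.Lam0 M.ζ < ⊤) (hτ : M.IsGrouping τ)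
    {c : ℕ × Ω → ℝ → ℝ} {c0 : ℝ → ℝ}
    (h : TendstoUniformlyOn c c0 (probFilter P) (Set.Icc 0 M.ζ)) :
    Tendsto (fun z : ℕ × Ω => ∑ t ∈ M.grid (τ z.1),
      M.dLam0Star (τ z.1) t * (c z t - c0 t)) (probFilter P) (𝓝 0) := by
  refine tendsto_sum_mul_sub h (D := (M.Lam0 M.ζ).toReal) (fun z t ht => ?_) (fun z => ?_)
  · obtain ⟨h0, m, hm⟩ := hτ z.1
    have ht' := M.mem_Ioc_of_mem_grid h0 hm ht
    exact ⟨Set.Ioc_subset_Icc_self ht', M.dLam0Star_nonneg hζ h0 ht'.2⟩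
  · obtain ⟨h0, m, hm⟩ := hτ z.1
    exact (M.sum_dLam0Star h0 hm).le

theorem S1_apply (τ : ℝ) (n : ℕ) (ω : Ω) (b : Fin d → ℝ) (t : ℝ) (k : Fin d) :
    M.S1 τ n ω b t k =
      ∑ i ∈ Finset.range n, M.Y τ i t ω * Real.exp (M.x i ⬝ᵥ b) * M.x i k := by
  simp [S1, Finset.sum_apply]

/-- The standardized score at `β` is negligible: its compensator is
`∑_t (S⁽¹⁾/n - (s⁽¹⁾/s⁽⁰⁾) S⁽⁰⁾/n)(β, t) dΛ₀*(t)`, up to negligible terms, and the integrand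
converges uniformly to zero. -/
theorem tendsto_score [IsProbabilityMeasure P] (hτ : M.IsGrouping τ)
    (hτ0 : Tendsto τ atTop (𝓝 0)) {E H R : ℝ} (hE : ∀ i, Real.exp (M.x i ⬝ᵥ M.β) ≤ E)
    (hH : ∀ᶠ n in atTop, ∀ t ∈ M.grid (τ n), M.dLam0Star (τ n) t ≤ H * τ n)
    (hR : ∀ i, ‖M.x i‖ ≤ R) (h7 : M.RegularLimits τ B s0 s1 s2) (k : Fin d) :
    Tendsto (fun z : ℕ × Ω => (z.1 : ℝ)⁻¹ * M.score (τ z.1) z.1 z.2 k) (probFilter P) (𝓝 0) := by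
  have hζ := h7.hazard_finite
  obtain ⟨m, K, hm, hb⟩ := M.exists_box h7
  set e : ℝ → ℝ := fun t => s1 M.β t k / s0 M.β t
  have he : ∀ t ∈ Set.Icc 0 M.ζ, |e t| ≤ K / m := by
    intro t ht
    have h0 := (hb t ht).1.1
    simp only [e, abs_div]
    have h1 := abs_le.2 ((hb t ht).2.1 k)
    have h2 : m ≤ |s0 M.β t| := h0.trans (le_abs_self _)
    gcongr
    exact (abs_nonneg _).trans h1
  have hw : ∀ i, ∀ t ∈ Set.Icc 0 M.ζ, |M.x i k - e t| ≤ R + K / m := by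
    intro i t ht
    have h1 : |M.x i k| ≤ R := (norm_le_pi_norm (M.x i) k).trans (hR i)
    exact (abs_sub _ _).trans (add_le_add h1 (he t ht))
  have hβ := tendsto_atBeta P M.β
  have c1 := M.tendsto_compensated hζ hτ hτ0 hE hH hw
  have c2 := M.tendsto_sum_dNsum_mul_sub hτ id ((M.uniform_qMean h7 k).comp_index hβ)
  have hu : TendstoUniformlyOn (fun (z : ℕ × Ω) t =>
      (z.1 : ℝ)⁻¹ * M.S1 (τ z.1) z.1 z.2 M.β t k - e t * ((z.1 : ℝ)⁻¹ * M.S0 (τ z.1) z.1 z.2 M.β t))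
      (fun _ => 0) (probFilter P) (Set.Icc 0 M.ζ) := by
    have h := (((M.uniform_S1 h7 k).comp_index hβ).pair
      ((TendstoUniformlyOn.const_index e _ _).pair
        ((M.uniform_S0 h7).comp_index hβ))).comp_of_isCompact
      ((isCompact_Icc (a := -K) (b := K)).prod ((isCompact_Icc (a := -(K / m)) (b := K / m)).prod
        (isCompact_Icc (a := m) (b := K))))
      (fun t ht => ⟨(hb t ht).2.1 k, abs_le.1 (he t ht), (hb t ht).1⟩)
      (Φ := fun p : ℝ × ℝ × ℝ => p.1 - p.2.1 * p.2.2) (fun a _ => by fun_prop)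
    refine h.congr_right fun t ht => ?_
    have : s0 M.β t ≠ 0 := (hm.trans_le (hb t ht).1.1).ne'
    simp only [e]
    field_simp
    ring
  have c3 := M.tendsto_sum_dLam0Star_mul_sub hζ hτ hu
  have c := (c1.add c3).sub c2
  simp only [add_zero, sub_zero] at c
  refine c.congr fun z => ?_
  obtain ⟨n, ω⟩ := z
  simp only [id]
  rw [Finset.sum_comm, score, Finset.mul_sum, Finset.mul_sum, ← Finset.sum_add_distrib,
    ← Finset.sum_sub_distrib]
  refine Finset.sum_congr rfl fun t _ => ?_
  rw [S1_apply, S0, dNsum]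
  simp only [Finset.mul_sum, Finset.sum_mul, mul_sub, ← Finset.sum_add_distrib,
    ← Finset.sum_sub_distrib]
  exact Finset.sum_congr rfl fun i _ => by ring

theorem tendsto_infoMatrix_apply [IsProbabilityMeasure P] (hτ : M.IsGrouping τ)
    (hτ0 : Tendsto τ atTop (𝓝 0)) {E H : ℝ} (hE : ∀ i, Real.exp (M.x i ⬝ᵥ M.β) ≤ E)
    (hH : ∀ᶠ n in atTop, ∀ t ∈ M.grid (τ n), M.dLam0Star (τ n) t ≤ H * τ n)
    (h7 : M.RegularLimits τ B s0 s1 s2) (k l : Fin d) :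
    Tendsto (fun y : (ℕ × Ω) × (Fin d → ℝ) =>
      (y.1.1 : ℝ)⁻¹ * M.infoMatrix (τ y.1.1) y.1.1 y.1.2 y.2 k l)
      (probFilter P ×ˢ 𝓝 M.β) (𝓝 (M.Sigma s0 s1 s2 M.β k l)) := by
  have hζ := h7.hazard_finite
  obtain ⟨m, K, hm, hb⟩ := M.exists_box h7
  obtain ⟨G, hG⟩ := M.exists_abs_limitCov_le h7 k l
  set g : ℝ → ℝ := fun t => limitCov s0 s1 s2 M.β t k l
  have hβ := tendsto_atBeta P M.β
  have c1 := M.tendsto_compensated hζ hτ hτ0 hE hH (w := fun _ => g) fun _ => hG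
  have c2 := M.tendsto_sum_dNsum_mul_sub hτ Prod.fst (M.uniform_qCov h7 k l)
  have hu : TendstoUniformlyOn (fun (z : ℕ × Ω) t =>
      g t * ((z.1 : ℝ)⁻¹ * M.S0 (τ z.1) z.1 z.2 M.β t))
      (fun t => g t * s0 M.β t) (probFilter P) (Set.Icc 0 M.ζ) :=
    ((TendstoUniformlyOn.const_index g _ _).pair
        ((M.uniform_S0 h7).comp_index hβ)).comp_of_isCompact
      ((isCompact_Icc (a := -G) (b := G)).prod (isCompact_Icc (a := m) (b := K)))
      (fun t ht => ⟨abs_le.1 (hG t ht), (hb t ht).1⟩)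
      (Φ := fun p : ℝ × ℝ => p.1 * p.2) (fun a _ => by fun_prop)
  have c3 := M.tendsto_sum_dLam0Star_mul_sub hζ hτ hu
  -- `g s⁽⁰⁾` is a continuous function of the `s⁽ʲ⁾`, which are continuous along the cell ends.
  have hlim : ∀ t ∈ Set.Ioc 0 M.ζ, Tendsto (fun n => g (cellEnd (τ n) t) *
      s0 M.β (cellEnd (τ n) t)) atTop (𝓝 (g t * s0 M.β t)) := by
    intro t ht
    have l0 := M.tendsto_cellEnd hτ ((M.uniform_S0 h7).comp_index hβ)
      (fun z t => by simp only [S0, M.Y_cellEnd (hτ z.1).1]) ht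
    have l1 := fun k => M.tendsto_cellEnd hτ ((M.uniform_S1 h7 k).comp_index hβ)
      (fun z t => by simp only [S1, M.Y_cellEnd (hτ z.1).1]) ht
    have l2 := M.tendsto_cellEnd hτ ((M.uniform_S2 h7 k l).comp_index hβ)
      (fun z t => by simp only [S2, M.Y_cellEnd (hτ z.1).1]) ht
    have h0 : s0 M.β t ≠ 0 := (hm.trans_le (hb t (Set.Ioc_subset_Icc_self ht)).1.1).ne'
    simp only [g, limitCov_apply]
    exact ((l2.div l0 h0).sub (((l1 k).div l0 h0).mul ((l1 l).div l0 h0))).mul l0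
  have hbound : ∀ t ∈ Set.Icc 0 M.ζ, |g t * s0 M.β t| ≤ G * K := by
    intro t ht
    rw [abs_mul, abs_of_nonneg (hm.le.trans (hb t ht).1.1)]
    exact mul_le_mul (hG t ht) (hb t ht).1.2 (hm.le.trans (hb t ht).1.1)
      ((abs_nonneg _).trans (hG t ht))
  have c4 := (M.tendsto_sum_dLam0Star_mul hζ hτ hbound hlim).comp
    (tendsto_fst_probFilter (P := P))
  have c5 := (c1.add (c3.add c4)).comp (tendsto_fst (f := probFilter P) (g := 𝓝 M.β))
  have c := c2.add c5
  simp only [zero_add] at c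
  refine c.congr fun y => ?_
  obtain ⟨⟨n, ω⟩, b⟩ := y
  simp only [Function.comp_apply]
  rw [Finset.sum_comm, infoMatrix, Matrix.sum_apply, Finset.mul_sum, Finset.mul_sum,
    ← Finset.sum_add_distrib, ← Finset.sum_add_distrib, ← Finset.sum_add_distrib]
  refine Finset.sum_congr rfl fun t _ => ?_
  have e1 : ∑ i ∈ Finset.range n, g t * (M.dN (τ n) i t ω -
      M.Y (τ n) i t ω * Real.exp (M.x i ⬝ᵥ M.β) * M.dLam0Star (τ n) t) =
      g t * (M.dNsum (τ n) n t ω - M.S0 (τ n) n ω M.β t * M.dLam0Star (τ n) t) := by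
    rw [← Finset.mul_sum, Finset.sum_sub_distrib, ← Finset.sum_mul]
    rfl
  rw [Matrix.smul_apply, smul_eq_mul, e1]
  simp only [g]
  ring

end limits

end CoxModel

/-! ### Inequalities for exponential means -/

/-- A quadratic lower bound for the cumulant generating function near the origin. -/
theorem mean_add_variance_le_log_sum_exp {ι : Type*} {s : Finset ι} {q z : ι → ℝ} {μ : ℝ}
    (hq : ∀ i ∈ s, 0 ≤ q i) (hq1 : ∑ i ∈ s, q i = 1) (hμ : ∑ i ∈ s, q i * z i = μ)
    (hz : ∀ i ∈ s, |z i - μ| ≤ 1) :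
    μ + (∑ i ∈ s, q i * (z i - μ) ^ 2) / 8 ≤ Real.log (∑ i ∈ s, q i * Real.exp (z i)) := by
  set v := ∑ i ∈ s, q i * (z i - μ) ^ 2 with hv
  have hv0 : 0 ≤ v := Finset.sum_nonneg fun i hi => mul_nonneg (hq i hi) (sq_nonneg _)
  have hv1 : v ≤ 1 := by
    rw [← hq1]
    refine Finset.sum_le_sum fun i hi => mul_le_of_le_one_right (hq i hi) ?_
    rw [← sq_abs]
    exact pow_le_one₀ (abs_nonneg _) (hz i hi)
  have hexp : ∀ u : ℝ, |u| ≤ 1 → 1 + u + u ^ 2 / 4 ≤ Real.exp u := by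
    intro u hu
    have h := Real.exp_bound hu (n := 3) (by norm_num)
    norm_num [Finset.sum_range_succ, Nat.factorial] at h
    have h3 : |u| ^ 3 ≤ u ^ 2 := by
      rw [← sq_abs u, pow_succ]
      exact mul_le_of_le_one_right (by positivity) hu
    nlinarith [(abs_le.1 h).1, sq_nonneg u]
  have hsum : 1 + v / 4 ≤ ∑ i ∈ s, q i * Real.exp (z i - μ) := by
    calc 1 + v / 4 = ∑ i ∈ s, q i * (1 + (z i - μ) + (z i - μ) ^ 2 / 4) := by
          have : ∀ i, q i * (1 + (z i - μ) + (z i - μ) ^ 2 / 4) =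
              q i + (q i * z i - q i * μ) + q i * (z i - μ) ^ 2 / 4 := fun i => by ring
          simp only [this, Finset.sum_add_distrib, Finset.sum_sub_distrib, ← Finset.sum_mul,
            ← Finset.sum_div, hq1, hμ, ← hv]
          ring
      _ ≤ _ := Finset.sum_le_sum fun i hi =>
          mul_le_mul_of_nonneg_left (hexp _ (hz i hi)) (hq i hi)
  have hfac : ∑ i ∈ s, q i * Real.exp (z i) =
      Real.exp μ * ∑ i ∈ s, q i * Real.exp (z i - μ) := by
    rw [Finset.mul_sum]
    refine Finset.sum_congr rfl fun i _ => ?_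
    rw [Real.exp_sub]
    field_simp
  rw [hfac, Real.log_mul (Real.exp_pos _).ne' (by linarith), Real.log_exp]
  have h1 : v / 8 ≤ Real.log (1 + v / 4) := by
    have h2 := Real.one_sub_inv_le_log_of_pos (by linarith : 0 < 1 + v / 4)
    have h3 : (1 + v / 4)⁻¹ ≤ 1 - v / 8 := by
      rw [inv_le_iff_one_le_mul₀ (by linarith)]
      nlinarith
    linarith
  linarith [Real.log_le_log (by linarith) hsum]

/-- Along rays the cumulant generating function grows at least linearly. -/
theorem mul_log_sum_exp_le {ι : Type*} {s : Finset ι} {q z : ι → ℝ} {c : ℝ}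
    (hq : ∀ i ∈ s, 0 ≤ q i) (hq1 : ∑ i ∈ s, q i = 1) (hc : 1 ≤ c) :
    c * Real.log (∑ i ∈ s, q i * Real.exp (z i)) ≤
      Real.log (∑ i ∈ s, q i * Real.exp (c * z i)) := by
  have hpos : 0 < ∑ i ∈ s, q i * Real.exp (z i) := by
    obtain ⟨i, hi, hqi⟩ : ∃ i ∈ s, 0 < q i := by
      by_contra! h
      have := Finset.sum_nonpos h
      linarith
    exact Finset.sum_pos' (fun j hj => mul_nonneg (hq j hj) (Real.exp_pos _).le)
      ⟨i, hi, mul_pos hqi (Real.exp_pos _)⟩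
  rw [← Real.log_rpow hpos]
  refine Real.log_le_log (Real.rpow_pos_of_pos hpos c) ?_
  refine (Real.rpow_arith_mean_le_arith_mean_rpow s q _ hq hq1
    (fun i _ => (Real.exp_pos _).le) hc).trans_eq ?_
  refine Finset.sum_congr rfl fun i _ => ?_
  rw [← Real.exp_mul, mul_comm (z i)]

namespace CoxModel

variable {Ω : Type*} [MeasurableSpace Ω] {P : Measure Ω} {d : ℕ} (M : CoxModel P d)

/-! ### The partial likelihood near and away from the true coefficients -/

/-- The logarithm of `L(β + h) / L(β)` for the Breslow partial likelihood `L`. -/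
noncomputable def logLikRatio (τ : ℝ) (n : ℕ) (ω : Ω) (h : Fin d → ℝ) : ℝ :=
  ∑ t ∈ M.grid τ, (∑ i ∈ Finset.range n, M.dN τ i t ω * (M.x i ⬝ᵥ h) -
    M.dNsum τ n t ω * Real.log (∑ i ∈ Finset.range n,
      M.q τ n ω M.β t i * Real.exp (M.x i ⬝ᵥ h)))

theorem breslowLik_pos (τ : ℝ) (n : ℕ) (ω : Ω) (b : Fin d → ℝ) : 0 < M.breslowLik τ n ω b :=
  Finset.prod_pos fun t _ => M.breslowTerm_pos τ n ω b t

theorem q_nonneg (τ : ℝ) (n : ℕ) (ω : Ω) (b : Fin d → ℝ) (t : ℝ) (i : ℕ) :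
    0 ≤ M.q τ n ω b t i := by
  have h : ∀ j, 0 ≤ M.Y τ j t ω * Real.exp (M.x j ⬝ᵥ b) := fun j =>
    mul_nonneg (M.Y_nonneg τ j t ω) (Real.exp_pos _).le
  exact div_nonneg (h i) (Finset.sum_nonneg fun j _ => h j)

theorem sum_q (τ : ℝ) (n : ℕ) (ω : Ω) (b : Fin d → ℝ) (t : ℝ) (h : M.S0 τ n ω b t ≠ 0) :
    ∑ i ∈ Finset.range n, M.q τ n ω b t i = 1 := by
  simp only [q, ← Finset.sum_div]
  exact div_self h

theorem log_breslowLik_add (τ : ℝ) (n : ℕ) (ω : Ω) (h : Fin d → ℝ) :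
    Real.log (M.breslowLik τ n ω (M.β + h)) =
      Real.log (M.breslowLik τ n ω M.β) + M.logLikRatio τ n ω h := by
  classical
  unfold breslowLik logLikRatio
  rw [Real.log_prod fun t _ => (M.breslowTerm_pos τ n ω _ t).ne',
    Real.log_prod fun t _ => (M.breslowTerm_pos τ n ω _ t).ne', ← Finset.sum_add_distrib]
  refine Finset.sum_congr rfl fun t _ => ?_
  rw [log_breslowTerm, log_breslowTerm, ← numEvents_cast]
  have h1 : ∑ i ∈ Finset.range n, M.dN τ i t ω * (M.x i ⬝ᵥ h) =
      ∑ i ∈ M.eventSet τ n t ω, M.x i ⬝ᵥ h := by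
    simp [eventSet, dN, Finset.sum_filter]
  have h2 : ∑ i ∈ M.eventSet τ n t ω, M.x i ⬝ᵥ (M.β + h) =
      ∑ i ∈ M.eventSet τ n t ω, M.x i ⬝ᵥ M.β + ∑ i ∈ M.eventSet τ n t ω, M.x i ⬝ᵥ h := by
    simp only [dotProduct_add, Finset.sum_add_distrib]
  rw [h1, h2]
  by_cases h0 : M.numEvents τ n t ω = 0
  · simp [h0]
  have p1 := M.S0_pos τ n ω M.β t h0
  have p2 := M.S0_pos τ n ω (M.β + h) t h0
  have h3 : ∑ i ∈ Finset.range n, M.q τ n ω M.β t i * Real.exp (M.x i ⬝ᵥ h) =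
      M.S0 τ n ω (M.β + h) t / M.S0 τ n ω M.β t := by
    conv_rhs => rw [S0, Finset.sum_div]
    refine Finset.sum_congr rfl fun i _ => ?_
    rw [q, dotProduct_add, Real.exp_add]
    ring
  rw [h3, Real.log_div p2.ne' p1.ne']
  ring

theorem S0_ne_zero_of_dNsum (τ : ℝ) (n : ℕ) (ω : Ω) (b : Fin d → ℝ) (t : ℝ)
    (h : M.dNsum τ n t ω ≠ 0) : M.S0 τ n ω b t ≠ 0 := by
  refine (M.S0_pos τ n ω b t fun h0 => h ?_).ne'
  rw [← numEvents_cast, h0, Nat.cast_zero]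

/-- Near the true coefficients the log likelihood ratio lies below a quadratic function whose
coefficients are the score and the information matrix at `β`. -/
theorem logLikRatio_le (τ : ℝ) (n : ℕ) (ω : Ω) {h : Fin d → ℝ}
    (hh : ∀ i, |M.x i ⬝ᵥ h| ≤ 1 / 2) :
    M.logLikRatio τ n ω h ≤ ∑ k, h k * M.score τ n ω k -
      (∑ k, ∑ l, h k * h l * M.infoMatrix τ n ω M.β k l) / 8 := by
  have e1 : ∑ k, h k * M.score τ n ω k = ∑ t ∈ M.grid τ,
      (∑ i ∈ Finset.range n, M.dN τ i t ω * (M.x i ⬝ᵥ h) -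
        M.dNsum τ n t ω * (M.qMean τ n ω M.β t ⬝ᵥ h)) := by
    simp only [score, Finset.mul_sum]
    rw [Finset.sum_comm]
    refine Finset.sum_congr rfl fun t _ => ?_
    rw [Finset.sum_comm, dNsum, Finset.sum_mul, ← Finset.sum_sub_distrib]
    refine Finset.sum_congr rfl fun i _ => ?_
    simp only [dotProduct, Finset.mul_sum, ← Finset.sum_sub_distrib]
    exact Finset.sum_congr rfl fun k _ => by ring
  have e2 : ∑ k, ∑ l, h k * h l * M.infoMatrix τ n ω M.β k l = ∑ t ∈ M.grid τ,
      M.dNsum τ n t ω * ∑ i ∈ Finset.range n, M.q τ n ω M.β t i *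
        (M.x i ⬝ᵥ h - M.qMean τ n ω M.β t ⬝ᵥ h) ^ 2 := by
    have e3 : ∀ k l, h k * h l * M.infoMatrix τ n ω M.β k l = ∑ t ∈ M.grid τ,
        M.dNsum τ n t ω * ∑ i ∈ Finset.range n, M.q τ n ω M.β t i *
          (((M.x i k - M.qMean τ n ω M.β t k) * h k) *
            ((M.x i l - M.qMean τ n ω M.β t l) * h l)) := by
      intro k l
      simp only [infoMatrix, qCov, Matrix.sum_apply, Matrix.smul_apply, Matrix.vecMulVec_apply,
        smul_eq_mul, Pi.sub_apply, Finset.mul_sum]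
      exact Finset.sum_congr rfl fun t _ => Finset.sum_congr rfl fun i _ => by ring
    simp only [e3]
    rw [Finset.sum_congr rfl fun k _ => Finset.sum_comm, Finset.sum_comm]
    refine Finset.sum_congr rfl fun t _ => ?_
    simp only [← Finset.mul_sum]
    congr 1
    rw [Finset.sum_congr rfl fun k _ => Finset.sum_comm, Finset.sum_comm]
    refine Finset.sum_congr rfl fun i _ => ?_
    simp only [← Finset.mul_sum]
    rw [← sub_dotProduct, sq, dotProduct, Finset.sum_mul_sum]
    simp only [Finset.mul_sum, Pi.sub_apply]
  rw [e1, e2, Finset.sum_div, ← Finset.sum_sub_distrib]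
  refine Finset.sum_le_sum fun t _ => ?_
  rcases (M.dNsum_nonneg τ n t ω).eq_or_lt with h0 | h0
  · simp [← h0]
  have hq := M.sum_q τ n ω M.β t (M.S0_ne_zero_of_dNsum τ n ω M.β t h0.ne')
  have hμ : ∑ i ∈ Finset.range n, M.q τ n ω M.β t i * (M.x i ⬝ᵥ h) =
      M.qMean τ n ω M.β t ⬝ᵥ h := by
    simp only [qMean, sum_dotProduct, smul_dotProduct, smul_eq_mul]
  have hμ' : |M.qMean τ n ω M.β t ⬝ᵥ h| ≤ 1 / 2 := by
    rw [← hμ]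
    calc _ ≤ ∑ i ∈ Finset.range n, M.q τ n ω M.β t i * (1 / 2) := by
          refine (Finset.abs_sum_le_sum_abs _ _).trans (Finset.sum_le_sum fun i _ => ?_)
          rw [abs_mul, abs_of_nonneg (M.q_nonneg _ _ _ _ _ _)]
          exact mul_le_mul_of_nonneg_left (hh i) (M.q_nonneg _ _ _ _ _ _)
      _ = 1 / 2 := by rw [← Finset.sum_mul, hq, one_mul]
  have key := mean_add_variance_le_log_sum_exp (fun i _ => M.q_nonneg τ n ω M.β t i) hq hμ
    (fun i _ => (abs_sub _ _).trans (by linarith [hh i]))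
  have := mul_le_mul_of_nonneg_left key h0.le
  linarith

/-- The form of concavity that is used: on a ray from the true coefficients, a negative log
likelihood ratio stays negative further out. -/
theorem logLikRatio_smul_le (τ : ℝ) (n : ℕ) (ω : Ω) (h : Fin d → ℝ) {c : ℝ} (hc : 1 ≤ c) :
    M.logLikRatio τ n ω (c • h) ≤ c * M.logLikRatio τ n ω h := by
  unfold logLikRatio
  rw [Finset.mul_sum]
  refine Finset.sum_le_sum fun t _ => ?_
  simp only [dotProduct_smul, smul_eq_mul]
  rcases (M.dNsum_nonneg τ n t ω).eq_or_lt with h0 | h0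
  · simp only [← h0, zero_mul, sub_zero, Finset.mul_sum]
    exact (Finset.sum_congr rfl fun i _ => by ring).le
  have hq := M.sum_q τ n ω M.β t (M.S0_ne_zero_of_dNsum τ n ω M.β t h0.ne')
  have key := mul_le_mul_of_nonneg_left (mul_log_sum_exp_le (z := fun i => M.x i ⬝ᵥ h)
    (fun i _ => M.q_nonneg τ n ω M.β t i) hq hc) h0.le
  have e : ∑ i ∈ Finset.range n, M.dN τ i t ω * (c * (M.x i ⬝ᵥ h)) =
      c * ∑ i ∈ Finset.range n, M.dN τ i t ω * (M.x i ⬝ᵥ h) := by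
    rw [Finset.mul_sum]
    exact Finset.sum_congr rfl fun i _ => by ring
  rw [e]
  linarith

theorem continuous_breslowLik (τ : ℝ) (n : ℕ) (ω : Ω) : Continuous (M.breslowLik τ n ω) := by
  refine continuous_finsetProd _ fun t _ => ?_
  have hx : ∀ i, Continuous fun b => M.x i ⬝ᵥ b := fun i => (M.dotCLM i).continuous
  unfold breslowTerm
  refine Continuous.div (by fun_prop) (by fun_prop) fun b => ?_
  rw [← S0_eq]
  by_cases h : M.numEvents τ n t ω = 0
  · simp [h]
  · have := M.S0_pos τ n ω b t h
    positivity

/-- If the likelihood is less than its value at `β` on a sphere around `β`, then it has a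
maximizer, and every maximizer lies in the ball. -/
theorem norm_sub_lt_of_isBreslowEstimator {τ : ℕ → ℝ} {βhat : ℕ → Ω → Fin d → ℝ}
    (hβ : M.IsBreslowEstimator τ βhat) {n : ℕ} {ω : Ω} {r : ℝ} (hr : 0 < r)
    (h : ∀ v : Fin d → ℝ, ‖v‖ = r → M.logLikRatio (τ n) n ω v < 0) :
    ‖βhat n ω - M.β‖ < r := by
  have hout : ∀ b, r ≤ ‖b - M.β‖ →
      M.breslowLik (τ n) n ω b < M.breslowLik (τ n) n ω M.β := by
    intro b hb
    have hpos : 0 < ‖b - M.β‖ := hr.trans_le hb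
    set v := (r / ‖b - M.β‖) • (b - M.β) with hv
    have hvr : ‖v‖ = r := by
      rw [hv, norm_smul, Real.norm_of_nonneg (by positivity)]
      field_simp
    have hc : 1 ≤ ‖b - M.β‖ / r := (one_le_div hr).2 hb
    have hbv : b = M.β + (‖b - M.β‖ / r) • v := by
      rw [hv, smul_smul]
      have : ‖b - M.β‖ / r * (r / ‖b - M.β‖) = 1 := by field_simp
      rw [this, one_smul, add_sub_cancel]
    rw [← Real.log_lt_log_iff (M.breslowLik_pos _ _ _ _) (M.breslowLik_pos _ _ _ _)]
    conv_lhs => rw [hbv]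
    rw [log_breslowLik_add]
    have h1 := M.logLikRatio_smul_le (τ n) n ω v hc
    have h2 := mul_neg_of_pos_of_neg (by positivity : 0 < ‖b - M.β‖ / r) (h v hvr)
    linarith
  obtain ⟨b₀, hb₀, hmax⟩ := (isCompact_closedBall M.β r).exists_isMaxOn
    ⟨M.β, Metric.mem_closedBall_self hr.le⟩ (M.continuous_breslowLik (τ n) n ω).continuousOn
  have hglob : IsMaxOn (M.breslowLik (τ n) n ω) Set.univ b₀ := by
    intro b _
    by_cases hb : b ∈ Metric.closedBall M.β r
    · exact hmax hb
    · have hb' : r ≤ ‖b - M.β‖ := by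
        rw [← dist_eq_norm]
        exact (not_le.1 hb).le
      exact (hout b hb').le.trans (hmax (Metric.mem_closedBall_self hr.le))
  by_contra hcon
  exact absurd (hβ n ω ⟨b₀, hglob⟩ (Set.mem_univ M.β)) (not_le.2 (hout _ (not_lt.1 hcon)))

/-! ### Consistency -/

theorem exists_pos_le_quadratic {A : Matrix (Fin d) (Fin d) ℝ} (hA : A.PosDef) {r : ℝ}
    (hr : 0 < r) :
    ∃ c, 0 < c ∧ ∀ v : Fin d → ℝ, ‖v‖ = r → c ≤ ∑ k, ∑ l, v k * v l * A k l := by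
  have hcont : Continuous fun v : Fin d → ℝ => ∑ k, ∑ l, v k * v l * A k l := by fun_prop
  obtain ⟨c, hc, h⟩ := (isCompact_sphere (0 : Fin d → ℝ) r).exists_forall_le'
    hcont.continuousOn (a := 0) (fun v hv => by
      have hv0 : v ≠ 0 := by
        rintro rfl
        simp at hv
        exact hr.ne hv
      have := hA.dotProduct_mulVec_pos hv0
      simp only [dotProduct, Matrix.mulVec, Finset.mul_sum, star_trivial] at this
      exact this.trans_eq (Finset.sum_congr rfl fun k _ => Finset.sum_congr rfl fun l _ => by ring))
  exact ⟨c, hc, fun v hv => h v (by simpa using hv)⟩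

/-- The estimator is consistent as soon as the standardized score at `β` tends to zero and the
standardized information matrix at `β` tends to a positive definite matrix. -/
theorem tendsto_estimator {τ : ℕ → ℝ} {βhat : ℕ → Ω → Fin d → ℝ}
    (hβ : M.IsBreslowEstimator τ βhat) {R : ℝ} (hR : ∀ i, ‖M.x i‖ ≤ R)
    {A : Matrix (Fin d) (Fin d) ℝ} (hA : A.PosDef)
    (hscore : ∀ k, Tendsto (fun z : ℕ × Ω => (z.1 : ℝ)⁻¹ * M.score (τ z.1) z.1 z.2 k)
      (probFilter P) (𝓝 0))
    (hinfo : ∀ k l, Tendsto (fun z : ℕ × Ω =>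
      (z.1 : ℝ)⁻¹ * M.infoMatrix (τ z.1) z.1 z.2 M.β k l) (probFilter P) (𝓝 (A k l))) :
    Tendsto (fun z : ℕ × Ω => βhat z.1 z.2) (probFilter P) (𝓝 M.β) := by
  have hR0 : 0 ≤ R := (norm_nonneg _).trans (hR 0)
  rw [Metric.tendsto_nhds]
  intro ε hε
  -- a radius at which the quadratic bound for the likelihood applies
  obtain ⟨r, hr, hrε, hrR⟩ : ∃ r, 0 < r ∧ r ≤ ε ∧ d * (R * r) ≤ 1 / 2 := by
    refine ⟨min ε (1 / (2 * (d * R + 1))), by positivity, min_le_left _ _, ?_⟩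
    have h1 : min ε (1 / (2 * (d * R + 1))) ≤ 1 / (2 * (d * R + 1)) := min_le_right _ _
    calc d * (R * min ε (1 / (2 * (d * R + 1)))) ≤ d * (R * (1 / (2 * (d * R + 1)))) := by gcongr
      _ ≤ 1 / 2 := by
          rw [← mul_assoc, mul_one_div, div_le_div_iff₀ (by positivity) (by norm_num)]
          linarith
  obtain ⟨c, hc, hcA⟩ := exists_pos_le_quadratic hA hr
  set D := d * r + d * (d * (r * r)) / 8 with hD
  have hD0 : 0 ≤ D := by positivity
  set η := c / 8 / (D + 1) with hη_def
  have hη : 0 < η := by positivity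
  have hηD : η * D < c / 8 := by
    rw [hη_def, div_mul_eq_mul_div, div_lt_iff₀ (by positivity)]
    nlinarith
  have h1 : ∀ᶠ z in probFilter P, ∀ k, |(z.1 : ℝ)⁻¹ * M.score (τ z.1) z.1 z.2 k| < η := by
    rw [eventually_all]
    intro k
    simpa [Real.dist_eq] using Metric.tendsto_nhds.1 (hscore k) η hη
  have h2 : ∀ᶠ z in probFilter P, ∀ k l,
      |(z.1 : ℝ)⁻¹ * M.infoMatrix (τ z.1) z.1 z.2 M.β k l - A k l| < η := by
    simp only [eventually_all]
    intro k l
    simpa [Real.dist_eq] using Metric.tendsto_nhds.1 (hinfo k l) η hη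
  filter_upwards [h1, h2] with z hU hI
  obtain ⟨n, ω⟩ := z
  simp only at hU hI ⊢
  rw [dist_eq_norm]
  refine (M.norm_sub_lt_of_isBreslowEstimator hβ hr fun v hv => ?_).trans_le hrε
  have hvk : ∀ k, |v k| ≤ r := fun k => hv ▸ norm_le_pi_norm v k
  have hxv : ∀ i, |M.x i ⬝ᵥ v| ≤ 1 / 2 := by
    intro i
    calc |M.x i ⬝ᵥ v| ≤ ∑ k : Fin d, R * r := by
          refine (Finset.abs_sum_le_sum_abs _ _).trans (Finset.sum_le_sum fun k _ => ?_)
          rw [abs_mul]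
          exact mul_le_mul ((norm_le_pi_norm (M.x i) k).trans (hR i)) (hvk k) (abs_nonneg _) hR0
      _ = d * (R * r) := by simp
      _ ≤ 1 / 2 := hrR
  have hle := mul_le_mul_of_nonneg_left (M.logLikRatio_le (τ n) n ω hxv)
    (by positivity : 0 ≤ (n : ℝ)⁻¹)
  have b1 : (n : ℝ)⁻¹ * ∑ k, v k * M.score (τ n) n ω k ≤ η * (d * r) := by
    calc _ = ∑ k, v k * ((n : ℝ)⁻¹ * M.score (τ n) n ω k) := by
          rw [Finset.mul_sum]; exact Finset.sum_congr rfl fun k _ => by ring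
      _ ≤ ∑ k : Fin d, r * η := Finset.sum_le_sum fun k _ => by
          refine (le_abs_self _).trans ?_
          rw [abs_mul]
          exact mul_le_mul (hvk k) (hU k).le (abs_nonneg _) hr.le
      _ = _ := by simp; ring
  have b2 : c - η * (d * (d * (r * r))) ≤
      (n : ℝ)⁻¹ * ∑ k, ∑ l, v k * v l * M.infoMatrix (τ n) n ω M.β k l := by
    have e : (n : ℝ)⁻¹ * ∑ k, ∑ l, v k * v l * M.infoMatrix (τ n) n ω M.β k l =
        ∑ k, ∑ l, v k * v l * A k l - ∑ k, ∑ l, v k * v l *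
          (A k l - (n : ℝ)⁻¹ * M.infoMatrix (τ n) n ω M.β k l) := by
      simp only [Finset.mul_sum, ← Finset.sum_sub_distrib]
      exact Finset.sum_congr rfl fun k _ => Finset.sum_congr rfl fun l _ => by ring
    have b : ∑ k, ∑ l, v k * v l * (A k l - (n : ℝ)⁻¹ * M.infoMatrix (τ n) n ω M.β k l) ≤
        η * (d * (d * (r * r))) := by
      calc _ ≤ ∑ k : Fin d, ∑ l : Fin d, r * r * η :=
            Finset.sum_le_sum fun k _ => Finset.sum_le_sum fun l _ => by
              refine (le_abs_self _).trans ?_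
              rw [abs_mul, abs_mul, abs_sub_comm]
              exact mul_le_mul (mul_le_mul (hvk k) (hvk l) (abs_nonneg _) hr.le) (hI k l).le
                (abs_nonneg _) (by positivity)
        _ = _ := by simp; ring
    linarith [hcA v hv]
  have hneg : (n : ℝ)⁻¹ * M.logLikRatio (τ n) n ω v < 0 := by
    rw [mul_sub, mul_div_assoc'] at hle
    rw [hD] at hηD
    linarith
  by_contra hcon
  exact absurd (mul_nonneg (by positivity : 0 ≤ (n : ℝ)⁻¹) (not_lt.1 hcon)) (not_le.2 hneg)

end CoxModel

theorem theorem2 {Ω : Type*} [MeasurableSpace Ω] (P : Measure Ω) [IsProbabilityMeasure P] {d : ℕ}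
    (M : CoxModel P d) (τ : ℕ → ℝ) (hτ : M.IsGrouping τ) (hτ0 : Tendsto τ atTop (𝓝 0))
    (h1 : M.SurvivorsAtEnd τ) (h2 : M.CompactCovariates) (h3 : M.HazardOrder τ)
    (h4 : M.RiskFraction τ) (h5 : M.TieOrder τ) (h6 : M.CondUncorrelated τ)
    (B : Set (Fin d → ℝ)) (s0 : (Fin d → ℝ) → ℝ → ℝ) (s1 : (Fin d → ℝ) → ℝ → Fin d → ℝ)
    (s2 : (Fin d → ℝ) → ℝ → Matrix (Fin d) (Fin d) ℝ) (h7 : M.RegularLimits τ B s0 s1 s2)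
    (βhat : ℕ → Ω → Fin d → ℝ) (hβ : M.IsBreslowEstimator τ βhat) :
    TendstoInMeasure P βhat atTop (fun _ => M.β) ∧
    TendstoInMeasure P (fun (n : ℕ) ω => (n : ℝ)⁻¹ • M.infoMatrix (τ n) n ω (βhat n ω)) atTop
      (fun _ => M.Sigma s0 s1 s2 M.β) ∧
    IsBigOP P (fun n ω => ⨆ t : M.grid (τ n), (M.numEvents (τ n) n t ω : ℝ))
      (fun n _ => (n : ℝ) * τ n) := by
  have hζ := h7.hazard_finite
  obtain ⟨R, hR⟩ : ∃ R, ∀ i, ‖M.x i‖ ≤ R := by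
    obtain ⟨K, hK, hxK⟩ := h2
    obtain ⟨R, hR⟩ := hK.isBounded.exists_norm_le
    exact ⟨R, fun i => hR _ (hxK i)⟩
  obtain ⟨E, hE⟩ : ∃ E, ∀ i, Real.exp (M.x i ⬝ᵥ M.β) ≤ E := by
    obtain ⟨K, hK, hxK⟩ := h2
    obtain ⟨E, hE⟩ := hK.exists_bound_of_continuousOn
      (f := fun x : Fin d → ℝ => Real.exp (x ⬝ᵥ M.β)) (by unfold dotProduct; fun_prop)
    exact ⟨E, fun i => (le_abs_self _).trans (hE _ (hxK i))⟩
  obtain ⟨H, hH0, hH⟩ : ∃ H, 0 < H ∧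
      ∀ᶠ n in atTop, ∀ t ∈ M.grid (τ n), M.dLam0Star (τ n) t ≤ H * τ n := by
    obtain ⟨H, hH0, hH⟩ := h3.exists_pos
    refine ⟨H, hH0, ?_⟩
    filter_upwards [hH.bound] with n hn t ht
    rw [Real.norm_of_nonneg (hτ n).1.le] at hn
    refine le_trans ?_ ((le_abs_self _).trans hn)
    exact le_ciSup (f := fun t : M.grid (τ n) => M.dLam0Star (τ n) t)
      (Set.finite_range _).bddAbove ⟨t, ht⟩
  have hinfo := M.tendsto_infoMatrix_apply hτ hτ0 hE hH h7
  have hinfoβ : ∀ k l, Tendsto (fun z : ℕ × Ω =>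
      (z.1 : ℝ)⁻¹ * M.infoMatrix (τ z.1) z.1 z.2 M.β k l) (probFilter P)
      (𝓝 (M.Sigma s0 s1 s2 M.β k l)) := by
    intro k l
    have h := (hinfo k l).comp (CoxModel.tendsto_atBeta P M.β)
    simp only [Function.comp_def] at h
    exact h
  have hcons := M.tendsto_estimator hβ hR (h7.posDef _ h7.mem)
    (M.tendsto_score hτ hτ0 hE hH hR h7) hinfoβ
  have hmat : Tendsto (fun z : ℕ × Ω =>
      (z.1 : ℝ)⁻¹ • M.infoMatrix (τ z.1) z.1 z.2 (βhat z.1 z.2)) (probFilter P)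
      (𝓝 (M.Sigma s0 s1 s2 M.β)) := by
    refine tendsto_pi_nhds.2 fun k => tendsto_pi_nhds.2 fun l => ?_
    have h := (hinfo k l).comp (tendsto_id.prodMk hcons)
    simp only [Function.comp_def, id] at h
    exact h
  refine ⟨tendstoInMeasure_of_tendsto_probFilter hcons, ?_,
    M.isBigOP_numEvents hζ hτ hE hH0 hH h5⟩
  exact tendstoInMeasure_of_tendsto_probFilter (P := P)
    (X := fun n ω => (n : ℝ)⁻¹ • M.infoMatrix (τ n) n ω (βhat n ω)) hmat
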